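/- Let $G=(V,A)$ be a finite directed acyclic graph (the preference graph) with $n=|V|$, whose vertices are called items. An item $u$ is dominated by an item $v$ if $u=v$ or $G$ contains a directed path from $v$ to $u$. An allocation to $k$ agents assigns pairwise disjoint sets $\pi(1),\dots,\pi(k)\subseteq V$ to the agents (items may stay unassigned); the dissatisfaction of agent $i$ is the number of items that are not dominated by any item of $\pi(i)$. The decision problem \textsc{CG Min-Max Dissatisfaction} asks, given $G$, the number $k$ of agents and an integer $d$, whether there is an allocation for which every agent has dissatisfaction at most $d$. An out-tree is a directed acyclic graph with a root $r$ such that for every vertex $v\neq r$ there is exactly one directed path from $r$ to $v$; an out-forest is a disjoint union of out-trees. Theorem. For every constant number $k$ of agents, \textsc{CG Min-Max Dissatisfaction} restricted to preference graphs $G$ that are out-forests can be solved in polynomial time. More precisely, for every $k$ there is an algorithm that solves it in time $O((n+1)^{2k+2})$, where the implied constants here and below depend only on $k$. (Here $G$ is given by $n$ and an arbitrarily ordered list of its arcs, and time is the number of steps of a random access machine that adds, subtracts, compares with zero, loads and stores words of $O(\log(n+|d|+2))$ bits, each in one step.) -/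

import Mathlib

namespace CommonGraph

/-! ### Directed graphs -/

section Graphs

variable {V : Type*}

/-- `p` lists the vertices of a (directed) path of `G` from `u` to `v`: consecutive vertices are
joined by arcs and all vertices are pairwise distinct. Length zero is allowed. -/
def IsPath (G : Digraph V) (u v : V) (p : List V) : Prop :=
  p.head? = some u ∧ p.getLast? = some v ∧ p.IsChain G.Adj ∧ p.Nodup

/-- `G` has no directed cycle: no vertex lies on a closed walk of positive length. In particular
there are no loops. -/
def IsAcyclic (G : Digraph V) : Prop :=
  ∀ v, ¬ Relation.TransGen G.Adj v v

/-- An out-tree: a directed acyclic graph with a root `r` such that for each vertex `v ≠ r` there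
is exactly one path from `r` to `v`. -/
def IsOutTree (G : Digraph V) : Prop :=
  IsAcyclic G ∧ ∃ r, ∀ v, v ≠ r → ∃! p, IsPath G r v p

/-- The subgraph of `G` induced by a set `S` of vertices. -/
def induce (G : Digraph V) (S : Set V) : Digraph S where
  Adj u v := G.Adj u v

/-- An out-forest: a disjoint union of out-trees. The vertex set is partitioned (into the classes
of an equivalence relation) such that no arc joins two different classes and each class induces
an out-tree. The empty graph is an out-forest. -/
def IsOutForest (G : Digraph V) : Prop :=
  ∃ c : Setoid V, (∀ u v, G.Adj u v → c u v) ∧ ∀ r, IsOutTree (induce G {v | c r v})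

/-- Item `u` is dominated by item `v`: `u = v`, or there is a path from `v` to `u`. -/
def Dominates (G : Digraph V) (v u : V) : Prop :=
  ∃ p, IsPath G v u p

end Graphs

/-! ### Allocations and the decision problem -/

section Problem

variable {V : Type*} {k : ℕ}

/-- An allocation assigns pairwise disjoint sets of items to the `k` agents (not all items have
to be assigned). -/
def IsAllocation (a : Fin k → Set V) : Prop :=
  ∀ i j, i ≠ j → Disjoint (a i) (a j)

/-- The dissatisfaction of agent `i`: the number of items not dominated by any item of `a i`. -/
noncomputable def dissatisfaction (G : Digraph V) (a : Fin k → Set V) (i : Fin k) : ℕ :=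
  {u : V | ¬ ∃ v ∈ a i, Dominates G v u}.ncard

/-- The question of Min-Max Dissatisfaction with a Common Preference Graph: is there an
allocation to `k` agents for which each agent has dissatisfaction at most `d`? -/
def MinMaxDissatisfaction (k : ℕ) (G : Digraph V) (d : ℤ) : Prop :=
  ∃ a : Fin k → Set V, IsAllocation a ∧ ∀ i, (dissatisfaction G a i : ℤ) ≤ d

end Problem

/-! ### Word random access machines

A machine has registers `0, 1, 2, …` and a memory with cells `0, 1, 2, …`; registers and cells
hold signed words. Its programs are built from elementary instructions by sequencing, branching
and loops. Each elementary instruction and each test costs one step. The only arithmetic is the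
addition and subtraction of words. -/

/-- Programs of the machine. Numbers are names of registers, except the second argument of
`const`, which is an integer constant. -/
inductive Prog : Type
  /-- Do nothing. -/
  | nop : Prog
  /-- Put the constant `c` into register `r`. -/
  | const (r : ℕ) (c : ℤ) : Prog
  /-- Put the sum of registers `x` and `y` into register `r`. -/
  | add (r x y : ℕ) : Prog
  /-- Put register `x` minus register `y` into register `r`. -/
  | sub (r x y : ℕ) : Prog
  /-- Put the memory cell whose address is in register `x` into register `r`. -/
  | load (r x : ℕ) : Prog
  /-- Put register `y` into the memory cell whose address is in register `x`. -/
  | store (x y : ℕ) : Prog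
  /-- Run the first program, then the second. -/
  | seq (p q : Prog) : Prog
  /-- If register `r` is positive, run `p`, else run `q`. -/
  | ifPos (r : ℕ) (p q : Prog) : Prog
  /-- As long as register `r` is positive, run `p`. -/
  | whilePos (r : ℕ) (p : Prog) : Prog

/-- The contents of the registers and of the memory. -/
structure State where
  reg : ℕ → ℤ
  mem : ℕ → ℤ

/-- The state after writing `x` into register `r`. -/
def State.setReg (s : State) (r : ℕ) (x : ℤ) : State :=
  { s with reg := Function.update s.reg r x }

/-- The state after writing `x` into memory cell `a`. -/
def State.setMem (s : State) (a : ℕ) (x : ℤ) : State :=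
  { s with mem := Function.update s.mem a x }

/-- `Exec W p s t s'`: on a machine whose words are the integers of absolute value at most `W`,
program `p` started in state `s` halts in state `s'` after exactly `t` steps. A program that
would create a number which is not a word, or that would use a negative address, crashes:
it has no halting run. -/
inductive Exec (W : ℕ) : Prog → State → ℕ → State → Prop
  | nop (s : State) : Exec W .nop s 1 s
  | const (s : State) (r : ℕ) (c : ℤ) (h : |c| ≤ W) :
      Exec W (.const r c) s 1 (s.setReg r c)
  | add (s : State) (r x y : ℕ) (h : |s.reg x + s.reg y| ≤ W) :
      Exec W (.add r x y) s 1 (s.setReg r (s.reg x + s.reg y))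
  | sub (s : State) (r x y : ℕ) (h : |s.reg x - s.reg y| ≤ W) :
      Exec W (.sub r x y) s 1 (s.setReg r (s.reg x - s.reg y))
  | load (s : State) (r x a : ℕ) (h : s.reg x = a) :
      Exec W (.load r x) s 1 (s.setReg r (s.mem a))
  | store (s : State) (x y a : ℕ) (h : s.reg x = a) :
      Exec W (.store x y) s 1 (s.setMem a (s.reg y))
  | seq {p q : Prog} {s s' s'' : State} {t t' : ℕ}
      (hp : Exec W p s t s') (hq : Exec W q s' t' s'') : Exec W (.seq p q) s (t + t') s''
  | ifPos_true {r : ℕ} {p q : Prog} {s s' : State} {t : ℕ} (h : 0 < s.reg r)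
      (hp : Exec W p s t s') : Exec W (.ifPos r p q) s (t + 1) s'
  | ifPos_false {r : ℕ} {p q : Prog} {s s' : State} {t : ℕ} (h : s.reg r ≤ 0)
      (hq : Exec W q s t s') : Exec W (.ifPos r p q) s (t + 1) s'
  | whilePos_true {r : ℕ} {p : Prog} {s s' s'' : State} {t t' : ℕ} (h : 0 < s.reg r)
      (hp : Exec W p s t s') (hw : Exec W (.whilePos r p) s' t' s'') :
      Exec W (.whilePos r p) s (t + t' + 1) s''
  | whilePos_false {r : ℕ} {p : Prog} {s : State} (h : s.reg r ≤ 0) :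
      Exec W (.whilePos r p) s 1 s

/-! ### Input -/

/-- `arcs` is a list, in any order and without repetitions, of all the arcs of `G`. -/
def IsArcList {V : Type*} (G : Digraph V) (arcs : List (V × V)) : Prop :=
  arcs.Nodup ∧ ∀ u v, (u, v) ∈ arcs ↔ G.Adj u v

/-- The input as a list of numbers: the number `n` of items, the number of arcs, the integer `d`,
and then the tail and the head of each arc. -/
def inputWords {n : ℕ} (arcs : List (Fin n × Fin n)) (d : ℤ) : List ℤ :=
  (n : ℤ) :: (arcs.length : ℤ) :: d ::
    arcs.flatMap fun e => [((e.1 : ℕ) : ℤ), ((e.2 : ℕ) : ℤ)]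

/-- The initial state: the input is in memory cells `0, 1, 2, …`; all other cells and all
registers are zero. -/
def initialState {n : ℕ} (arcs : List (Fin n × Fin n)) (d : ℤ) : State where
  reg _ := 0
  mem a := (inputWords arcs d).getD a 0

end CommonGraph

namespace CommonGraph

/-! In an out-forest each item has at most one parent, so two items that dominate a common item are
comparable. Dropping from each bundle the items dominated by another item of the same bundle changes
no dissatisfaction. What remains is a colouring in which no agent owns two comparable items, so the
subtrees below the items of one agent are disjoint, and the agent's dissatisfaction is `n` minus its
score, the sum of the sizes of these subtrees (`minMaxDissatisfaction_iff`). Only the vector of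
scores matters. Scores are at most `n`, so the vector is a number below `N = (n + 1) ^ k` written in
base `n + 1` without carries (`code_digit_and_lt`).

The set of achievable codes is computed bottom up. Codes of mutually incomparable families of items
simply add (`codes_union`). An item `v` may go to agent `i` exactly if `i` owns nothing strictly
below `v`; as subtree sizes are positive, the code shows this by its digit `i` being zero
(`codes_subtree`). Items are numbered from one, and number `0` is a virtual root above all roots;
its table finally holds the codes of all valid allocations (`available_univ`), and the answer is yes
iff one of them has all its `k` digits at least `n - d`. Children have smaller subtrees than their
parents, so items are handled in order of subtree size; `tables_insert` describes one such step.

On the machine, a set of codes is a 0/1 array of length `N`. It is extended in place while its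
indices are scanned downwards; new entries never lie below the current index, so the scan never
reads them. For `k ≥ 1` an item costs `O(N ^ 2)`, because of the sums of pairs. The main loop makes
`n` passes over the `n` items, one pass for each size. Even charging every visit with a complete
processing gives `n ^ 2 * N ^ 2 ≤ (n + 1) ^ (2 * k + 2)`, and the remaining work is of lower or
equal order. In the verification, `Runs` is total correctness with a time bound, and `Frame`
expresses that inner programs only use registers of lower number than those the outer ones still
need. -/

/-! ### Running programs with a time bound -/

/-- Started in `s`, the program `p` halts within `T` steps in a state satisfying `Q`. -/
def Runs (W : ℕ) (p : Prog) (s : State) (T : ℕ) (Q : State → Prop) : Prop :=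
  ∃ t s', Exec W p s t s' ∧ t ≤ T ∧ Q s'

/-- The states agree on all registers from `b` on. -/
def Frame (b : ℕ) (s s' : State) : Prop :=
  ∀ x, b ≤ x → s'.reg x = s.reg x

theorem State.reg_setReg (s : State) (r : ℕ) (v : ℤ) (x : ℕ) :
    (s.setReg r v).reg x = if x = r then v else s.reg x := by
  simp [State.setReg, Function.update_apply]

@[simp] theorem State.mem_setReg (s : State) (r : ℕ) (v : ℤ) : (s.setReg r v).mem = s.mem := rfl

@[simp] theorem State.reg_setMem (s : State) (a : ℕ) (v : ℤ) : (s.setMem a v).reg = s.reg := rfl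

@[simp] theorem State.mem_setMem (s : State) (a : ℕ) (v : ℤ) :
    (s.setMem a v).mem = Function.update s.mem a v := rfl

namespace Frame

@[simp] theorem refl (b : ℕ) (s : State) : Frame b s s := fun _ _ => rfl

theorem trans {b : ℕ} {s₁ s₂ s₃ : State} (h : Frame b s₁ s₂) (h' : Frame b s₂ s₃) :
    Frame b s₁ s₃ := fun x hx => (h' x hx).trans (h x hx)

theorem mono {b b' : ℕ} {s s' : State} (h : Frame b s s') (hb : b ≤ b') : Frame b' s s' :=
  fun x hx => h x (hb.trans hx)

theorem setReg {b r : ℕ} {s s' : State} {v : ℤ} (h : Frame b s s') (hr : r < b) :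
    Frame b s (s'.setReg r v) := fun x hx => by
  rw [State.reg_setReg, if_neg (by omega)]
  exact h x hx

theorem setMem {b a : ℕ} {s s' : State} {v : ℤ} (h : Frame b s s') : Frame b s (s'.setMem a v) := h

end Frame

namespace Runs

variable {W T T₁ T₂ r x y : ℕ} {c : ℤ} {p q : Prog} {s : State} {Q R : State → Prop}

theorem mono (h : Runs W p s T₁ R) (hT : T₁ ≤ T) (hQ : ∀ s', R s' → Q s') : Runs W p s T Q := by
  obtain ⟨t, s', he, ht, hr⟩ := h
  exact ⟨t, s', he, ht.trans hT, hQ _ hr⟩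

theorem nop (hQ : Q s) : Runs W .nop s (T + 1) Q := ⟨1, _, .nop s, by omega, hQ⟩

theorem const (h : |c| ≤ W) (hQ : Q (s.setReg r c)) : Runs W (.const r c) s (T + 1) Q :=
  ⟨1, _, .const s r c h, by omega, hQ⟩

theorem add (h : |s.reg x + s.reg y| ≤ W) (hQ : Q (s.setReg r (s.reg x + s.reg y))) :
    Runs W (.add r x y) s (T + 1) Q := ⟨1, _, .add s r x y h, by omega, hQ⟩

theorem sub (h : |s.reg x - s.reg y| ≤ W) (hQ : Q (s.setReg r (s.reg x - s.reg y))) :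
    Runs W (.sub r x y) s (T + 1) Q := ⟨1, _, .sub s r x y h, by omega, hQ⟩

theorem load {a : ℕ} (h : s.reg x = a) (hQ : Q (s.setReg r (s.mem a))) :
    Runs W (.load r x) s (T + 1) Q := ⟨1, _, .load s r x a h, by omega, hQ⟩

theorem store {a : ℕ} (h : s.reg x = a) (hQ : Q (s.setMem a (s.reg y))) :
    Runs W (.store x y) s (T + 1) Q := ⟨1, _, .store s x y a h, by omega, hQ⟩

theorem seq (hp : Runs W p s T₁ R) (hT : T₁ + T₂ ≤ T) (hq : ∀ s', R s' → Runs W q s' T₂ Q) :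
    Runs W (.seq p q) s T Q := by
  obtain ⟨t, s', he, ht, hr⟩ := hp
  obtain ⟨t', s'', he', ht', hr'⟩ := hq s' hr
  exact ⟨t + t', s'', .seq he he', by omega, hr'⟩

/-- The `seq_` rules execute one leading instruction symbolically and take one unit off the time
bound. -/
theorem seq_const (hW : |c| ≤ W) (h : Runs W q (s.setReg r c) T Q) :
    Runs W (.seq (.const r c) q) s (T + 1) Q :=
  seq (T₁ := 1) (T₂ := T) (const (T := 0) (Q := fun s' => s' = _) hW rfl) (by omega) (by rintro _ rfl; exact h)

theorem seq_add (hW : |s.reg x + s.reg y| ≤ W)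
    (h : Runs W q (s.setReg r (s.reg x + s.reg y)) T Q) :
    Runs W (.seq (.add r x y) q) s (T + 1) Q :=
  seq (T₁ := 1) (T₂ := T) (add (T := 0) (Q := fun s' => s' = _) hW rfl) (by omega) (by rintro _ rfl; exact h)

theorem seq_sub (hW : |s.reg x - s.reg y| ≤ W)
    (h : Runs W q (s.setReg r (s.reg x - s.reg y)) T Q) :
    Runs W (.seq (.sub r x y) q) s (T + 1) Q :=
  seq (T₁ := 1) (T₂ := T) (sub (T := 0) (Q := fun s' => s' = _) hW rfl) (by omega) (by rintro _ rfl; exact h)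

theorem seq_load {a : ℕ} (ha : s.reg x = a) (h : Runs W q (s.setReg r (s.mem a)) T Q) :
    Runs W (.seq (.load r x) q) s (T + 1) Q :=
  seq (T₁ := 1) (T₂ := T) (load (T := 0) (Q := fun s' => s' = _) ha rfl) (by omega) (by rintro _ rfl; exact h)

theorem seq_store {a : ℕ} (ha : s.reg x = a) (h : Runs W q (s.setMem a (s.reg y)) T Q) :
    Runs W (.seq (.store x y) q) s (T + 1) Q :=
  seq (T₁ := 1) (T₂ := T) (store (T := 0) (Q := fun s' => s' = _) ha rfl) (by omega) (by rintro _ rfl; exact h)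

theorem ifPos (hp : 0 < s.reg r → Runs W p s T Q) (hq : s.reg r ≤ 0 → Runs W q s T Q) :
    Runs W (.ifPos r p q) s (T + 1) Q := by
  by_cases h : 0 < s.reg r
  · obtain ⟨t, s', he, ht, hr⟩ := hp h
    exact ⟨t + 1, s', .ifPos_true h he, by omega, hr⟩
  · obtain ⟨t, s', he, ht, hr⟩ := hq (not_lt.1 h)
    exact ⟨t + 1, s', .ifPos_false (not_lt.1 h) he, by omega, hr⟩

theorem while_false (h : s.reg r ≤ 0) (hQ : Q s) : Runs W (.whilePos r p) s (T + 1) Q :=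
  ⟨1, s, .whilePos_false h, by omega, hQ⟩

theorem while_true (h : 0 < s.reg r) (hp : Runs W p s T₁ R) (hT : T₁ + T₂ + 1 ≤ T)
    (hw : ∀ s', R s' → Runs W (.whilePos r p) s' T₂ Q) : Runs W (.whilePos r p) s T Q := by
  obtain ⟨t, s', he, ht, hr⟩ := hp
  obtain ⟨t', s'', he', ht', hr'⟩ := hw s' hr
  exact ⟨t + t' + 1, s'', .whilePos_true h he he', by omega, hr'⟩

/-- A loop with an invariant that counts the remaining iterations. -/
theorem while_count (I : ℕ → State → Prop) (C : ℕ)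
    (hstep : ∀ j s, I (j + 1) s → 0 < s.reg r ∧ Runs W p s C (I j))
    (hend : ∀ s, I 0 s → s.reg r ≤ 0) (m : ℕ) :
    ∀ s, I m s → Runs W (.whilePos r p) s (m * (C + 1) + 1) (I 0) := by
  induction m with
  | zero => exact fun s h => while_false (hend s h) h
  | succ m ih =>
    intro s h
    obtain ⟨h₁, h₂⟩ := hstep m s h
    exact while_true h₁ h₂ (by ring_nf; omega) ih

end Runs

/-! ### Registers with a fixed meaning -/

/-- The register that holds the number of items. -/
local notation "rN" => 40
/-- The register that holds the number of arcs. -/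
local notation "rM" => 41
/-- The register that holds the bound on the dissatisfaction. -/
local notation "rD" => 42
/-- The register that holds one. -/
local notation "rOne" => 43
/-- The register that holds zero. -/
local notation "rZero" => 44
/-- The register that holds the base of the encoding of vectors. -/
local notation "rB" => 45
/-- The register that holds the size of a table. -/
local notation "rL" => 46
/-- The register that holds the address of the array of parents. -/
local notation "rX" => 47
/-- The register that holds the address of the array of subtree sizes. -/
local notation "rY" => 48
/-- The register that holds the address of the first table. -/
local notation "rZ" => 49

/-! ### Loops and arithmetic -/

/-- Run `body` for all values of register `c` below the initial one, in decreasing order. -/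
def forDown (c : ℕ) (body : Prog) : Prog :=
  .whilePos c (.seq (.sub c c rOne) body)

/-- The body may only change registers below the counter `c`, so the counter and everything above it
survive. The decrement writes `c` itself, hence `hset`: the invariant must not depend on a register
write to `c`. An iteration costs two steps beyond the body, for the test and the decrement. -/
theorem Runs.forDown {W c m C : ℕ} {body : Prog} {s₀ : State} (P : ℕ → State → Prop)
    (hc : c < rN) (hone : s₀.reg rOne = 1) (hm : s₀.reg c = m) (hW : m ≤ W) (hP : P m s₀)
    (hset : ∀ j s v, P j s → P j (s.setReg c v))
    (hbody : ∀ j < m, ∀ s, Frame (c + 1) s₀ s → s.reg c = j → P (j + 1) s →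
      Runs W body s C (fun s' => Frame c s s' ∧ P j s')) :
    Runs W (forDown c body) s₀ (m * (C + 2) + 1) (fun s' => Frame (c + 1) s₀ s' ∧ P 0 s') := by
  refine Runs.mono (Runs.while_count
    (fun j s => Frame (c + 1) s₀ s ∧ s.reg c = j ∧ P j s ∧ j ≤ m) (C + 1) ?_ ?_ m s₀
    ⟨Frame.refl _ _, hm, hP, le_rfl⟩) le_rfl fun s h => ⟨h.1, h.2.2.1⟩
  · rintro j s ⟨hF, hj, hPj, hjm⟩
    have h1 : s.reg rOne = 1 := (hF rOne (by omega)).trans hone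
    refine ⟨by rw [hj]; positivity, Runs.seq_sub ?_ ?_⟩
    · rw [hj, h1]; push_cast; rw [add_sub_cancel_right, Nat.abs_cast]; exact_mod_cast (by omega)
    · rw [hj, h1]
      have h2 : (((j + 1 : ℕ) : ℤ) - 1) = j := by push_cast; ring
      rw [h2]
      have hF' : Frame (c + 1) s₀ (s.setReg c j) := hF.setReg (by omega)
      refine (hbody j (by omega) _ hF' (by simp [State.reg_setReg]) (hset _ _ _ hPj)).mono le_rfl
        fun s' h => ⟨hF'.trans (h.1.mono (by omega)), ?_, h.2, by omega⟩
      rw [h.1 c le_rfl]; simp [State.reg_setReg]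
  · rintro s ⟨-, hj, -⟩; simp [hj]

/-- Put the product of registers `x` and `y` into register `0`. -/
def mulProg (x y : ℕ) : Prog :=
  .seq (.const 0 0) (.seq (.add 1 x rZero) (forDown 1 (.add 0 0 y)))

/-- Repeated addition costs time linear in the first factor only; callers therefore pass the item
number or the base first and the possibly huge factor second. -/
theorem runs_mulProg {W x y a b : ℕ} {s : State} (hx : 2 ≤ x) (hy : 2 ≤ y)
    (hone : s.reg rOne = 1) (hzero : s.reg rZero = 0) (ha : s.reg x = a) (hb : s.reg y = b)
    (hW : a * b ≤ W) (hW' : a ≤ W) :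
    Runs W (mulProg x y) s (a * 3 + 3) (fun s' => Frame 2 s s' ∧ s'.reg 0 = (a * b : ℕ) ∧
      s'.mem = s.mem) := by
  unfold mulProg
  refine Runs.seq_const (by simp) (Runs.seq_add ?_ ?_)
  · simpa [State.reg_setReg, hzero, ha, show x ≠ 0 by omega] using hW'
  set s₀ := (s.setReg 0 0).setReg 1 ((s.setReg 0 0).reg x + (s.setReg 0 0).reg rZero) with hs₀
  have hF : Frame 2 s s₀ := ((Frame.refl 2 s).setReg (by omega)).setReg (by omega)
  refine Runs.mono (Runs.forDown (m := a) (C := 1)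
    (fun j s' => s'.reg 0 = ((a - j) * b : ℕ) ∧ s'.mem = s.mem) (by norm_num)
    ((hF _ (by norm_num)).trans hone) ?_ hW' ?_ ?_ ?_) (by omega) ?_
  · simp [hs₀, State.reg_setReg, hzero, ha, show x ≠ 0 by omega]
  · simp [hs₀, State.reg_setReg]
  · rintro j s' v h; simpa [State.reg_setReg] using h
  · rintro j hj s' hF' hj' ⟨h0, hm⟩
    have hb' : s'.reg y = b := by rw [hF' y hy, hF y hy, hb]
    have e : ((a - (j + 1)) * b + b : ℕ) = (a - j) * b := by
      rw [show a - j = (a - (j + 1)) + 1 by omega]; ring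
    have e' : s'.reg 0 + s'.reg y = ((a - j) * b : ℕ) := by rw [h0, hb', ← e]; push_cast; ring
    refine Runs.add (T := 0) ?_ ⟨(Frame.refl _ _).setReg (by omega), ?_, hm⟩
    · rw [e', Nat.abs_cast]
      exact_mod_cast (Nat.mul_le_mul_right b (Nat.sub_le a j)).trans hW
    · simp [State.reg_setReg, e']
  · rintro s' ⟨hF', h0, hm⟩
    exact ⟨hF.trans hF', by simpa using h0, hm⟩

/-- Divide register `2` by the base; the quotient goes to register `0`, the remainder to
register `2`. -/
def divProg : Prog :=
  .seq (.const 0 0) (.seq (.sub 1 2 rB) (.seq (.add 1 1 rOne)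
    (.whilePos 1 (.seq (.sub 2 2 rB) (.seq (.add 0 0 rOne) (.sub 1 1 rB))))))

/-- Register `1` is kept at the current remainder minus `B` plus one, which is positive exactly
while another subtraction is possible. With `j` subtractions to go the remainder is `B * j + a % B`.
-/
theorem runs_divProg {W B a : ℕ} {s : State} (hone : s.reg rOne = 1) (hB : s.reg rB = B)
    (hB0 : 0 < B) (ha : s.reg 2 = a) (hW : a + B ≤ W) :
    Runs W divProg s (a / B * 4 + 4) (fun s' => Frame 3 s s' ∧ s'.reg 0 = (a / B : ℕ) ∧
      s'.reg 2 = (a % B : ℕ) ∧ s'.mem = s.mem) := by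
  unfold divProg
  have hWz : (a : ℤ) + B ≤ W := by exact_mod_cast hW
  have hB0z : (1 : ℤ) ≤ B := by exact_mod_cast hB0
  refine Runs.seq_const (by simp) (Runs.seq_sub ?_ (Runs.seq_add ?_ ?_))
  · simp only [State.reg_setReg]; norm_num [ha, hB, abs_le]; omega
  · simp only [State.reg_setReg]; norm_num [ha, hB, hone, abs_le]; omega
  set s₀ := State.setReg _ 1 _ with hs₀
  have hF : Frame 3 s s₀ :=
    (((Frame.refl 3 s).setReg (by omega)).setReg (by omega)).setReg (by omega)
  have hda : (a : ℤ) = B * (a / B : ℕ) + (a % B : ℕ) := by exact_mod_cast (Nat.div_add_mod a B).symm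
  have hmod : ((a % B : ℕ) : ℤ) < B := by exact_mod_cast Nat.mod_lt a hB0
  refine Runs.mono (Runs.while_count (fun j s' => Frame 3 s s' ∧ j ≤ a / B ∧
    s'.reg 0 = ((a / B - j : ℕ) : ℤ) ∧ s'.reg 2 = (B : ℤ) * j + (a % B : ℕ) ∧
    s'.reg 1 = s'.reg 2 - B + 1 ∧ s'.mem = s.mem) 3 ?_ ?_ (a / B) s₀ ?_) (by omega) ?_
  · rintro j s' ⟨hF', hj, h0, h2, h1, hm⟩
    have hB' : s'.reg rB = B := (hF' _ (by norm_num)).trans hB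
    have hone' : s'.reg rOne = 1 := (hF' _ (by norm_num)).trans hone
    have hjB : (B : ℤ) * (j + 1 : ℕ) ≤ B * (a / B : ℕ) := by
      exact_mod_cast Nat.mul_le_mul_left B hj
    have hjB0 : (0 : ℤ) ≤ B * (j : ℤ) := by positivity
    have hdv : a / B ≤ a := Nat.div_le_self a B
    push_cast at h2 hjB hda hmod
    have hmod0 : (0 : ℤ) ≤ (a : ℤ) % B := Int.emod_nonneg _ (by omega)
    refine ⟨by rw [h1, h2]; linarith, Runs.seq_sub ?_ (Runs.seq_add ?_ (Runs.sub (T := 0) ?_ ?_))⟩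
    · rw [h2, hB', abs_le]; constructor <;> linarith
    · simp only [State.reg_setReg]; norm_num [h0, hone', abs_le]; omega
    · simp only [State.reg_setReg]; norm_num [h1, h2, hB', abs_le]; constructor <;> linarith
    · refine ⟨((hF'.setReg (by omega)).setReg (by omega)).setReg (by omega), by omega, ?_, ?_, ?_,
        by simpa using hm⟩ <;> simp only [State.reg_setReg] <;> norm_num [h0, h1, h2, hB', hone']
      · omega
      · ring
      · ring
  · rintro s' ⟨-, -, -, h2, h1, -⟩
    rw [h1, h2]; push_cast at *; linarith
  · refine ⟨hF, le_rfl, ?_, ?_, ?_, ?_⟩ <;> simp only [hs₀, State.reg_setReg] <;>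
      norm_num [ha, hB, hone]
    push_cast at hda; exact hda
  · rintro s' ⟨hF', -, h0, h2, -, hm⟩
    exact ⟨hF', by simpa using h0, by simpa using h2, hm⟩

/-! ### Memory layout -/

open Classical in
/-- The memory: the input in the cells below `X`, then the arrays `par` and `sz` with `B` entries
each, then for each `w < B` a table with `N` entries that represents the set `F w`. -/
noncomputable def memOf (B N X : ℕ) (inp : ℕ → ℤ) (par sz : ℕ → ℕ) (F : ℕ → Set ℕ) (a : ℕ) : ℤ :=
  if a < X then inp a
  else if a < X + B then par (a - X)
  else if a < X + 2 * B then sz (a - (X + B))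
  else if (a - (X + 2 * B)) % N ∈ F ((a - (X + 2 * B)) / N) then 1 else 0

section Memory

variable {B N X w a : ℕ} {inp : ℕ → ℤ} {par sz : ℕ → ℕ} {F : ℕ → Set ℕ}

theorem memOf_inp (h : a < X) : memOf B N X inp par sz F a = inp a := by
  simp [memOf, h]

theorem memOf_par (h : w < B) : memOf B N X inp par sz F (X + w) = par w := by
  simp [memOf, h]

theorem memOf_sz (h : w < B) : memOf B N X inp par sz F (X + B + w) = sz w := by
  rw [memOf, if_neg (by omega), if_neg (by omega), if_pos (by omega), Nat.add_sub_cancel_left]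

open Classical in
theorem memOf_table (h : a < N) : memOf B N X inp par sz F (X + 2 * B + w * N + a) =
    if a ∈ F w then 1 else 0 := by
  rw [memOf, if_neg (by omega), if_neg (by omega), if_neg (by omega),
    show X + 2 * B + w * N + a - (X + 2 * B) = a + N * w by rw [mul_comm N]; omega,
    Nat.add_mul_mod_self_left, Nat.mod_eq_of_lt h, Nat.add_mul_div_left _ _ (by omega),
    Nat.div_eq_of_lt h, zero_add]

theorem memOf_table_pos (h : a < N) :
    0 < memOf B N X inp par sz F (X + 2 * B + w * N + a) ↔ a ∈ F w := by
  rw [memOf_table h]; split_ifs with h' <;> simp [h']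

/-- This and the next two lemmas turn a write to one cell into an update of the abstract arrays or
sets, so that loop invariants can speak of those alone. -/
theorem update_memOf_par (h : w < B) (v : ℕ) :
    Function.update (memOf B N X inp par sz F) (X + w) v =
      memOf B N X inp (Function.update par w v) sz F := by
  funext a
  by_cases ha : a = X + w
  · subst ha; rw [Function.update_self, memOf_par h, Function.update_self]
  · rw [Function.update_of_ne ha]
    unfold memOf
    split_ifs with h1 h2 <;> try rfl
    rw [Function.update_of_ne (by omega)]

theorem update_memOf_sz (h : w < B) (v : ℕ) :
    Function.update (memOf B N X inp par sz F) (X + B + w) v =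
      memOf B N X inp par (Function.update sz w v) F := by
  funext a
  by_cases ha : a = X + B + w
  · subst ha; rw [Function.update_self, memOf_sz h, Function.update_self]
  · rw [Function.update_of_ne ha]
    unfold memOf
    split_ifs with h1 h2 h3 <;> try rfl
    rw [Function.update_of_ne (by omega)]

theorem update_memOf_table (h : a < N) :
    Function.update (memOf B N X inp par sz F) (X + 2 * B + w * N + a) 1 =
      memOf B N X inp par sz (Function.update F w (insert a (F w))) := by
  funext b
  by_cases hb : b = X + 2 * B + w * N + a
  · subst hb; rw [Function.update_self, memOf_table h, Function.update_self]; simp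
  · rw [Function.update_of_ne hb]
    unfold memOf
    split_ifs with h1 h2 h3 h4 h5 h5 <;> try rfl
    · refine absurd ?_ h5
      by_cases hw : (b - (X + 2 * B)) / N = w
      · rw [hw, Function.update_self]; rw [hw] at h4; exact Or.inr h4
      · rwa [Function.update_of_ne hw]
    · exfalso
      by_cases hw : (b - (X + 2 * B)) / N = w
      · rw [hw, Function.update_self] at h5
        rcases h5 with h5 | h5
        · have := Nat.div_add_mod (b - (X + 2 * B)) N
          rw [hw, h5, mul_comm] at this
          omega
        · rw [hw] at h4; exact h4 h5
      · rw [Function.update_of_ne hw] at h5; exact h4 h5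

end Memory

/-- The registers with a fixed meaning have their values, and the words are large enough. -/
structure Env (W B N X : ℕ) (d : ℤ) (s : State) : Prop where
  n : s.reg rN = B - 1
  bound : s.reg rD = d
  one : s.reg rOne = 1
  zero : s.reg rZero = 0
  base : s.reg rB = B
  len : s.reg rL = N
  par : s.reg rX = X
  sz : s.reg rY = X + B
  table : s.reg rZ = X + 2 * B
  base_pos : 0 < B
  len_pos : 0 < N
  word : X + 4 * B + 4 * (B * N) + d.natAbs ≤ W

/-- All registers with a fixed meaning have numbers from 40 on, and scratch registers lie below. -/
theorem Env.frame {W B N X b : ℕ} {d : ℤ} {s s' : State} (h : Env W B N X d s)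
    (hF : Frame b s s') (hb : b ≤ 40) : Env W B N X d s' := by
  have e : ∀ x, 40 ≤ x → s'.reg x = s.reg x := fun x hx => hF x (hb.trans hx)
  obtain ⟨h1, h2, h3, h4, h5, h6, h7, h8, h9, h10, h11, h12⟩ := h
  refine ⟨?_, ?_, ?_, ?_, ?_, ?_, ?_, ?_, ?_, h10, h11, h12⟩ <;> rwa [e _ (by norm_num)]

/-! ### Giving an item to one of the agents -/

/-- The numbers obtained from `a` by putting `m` in place of one of its last `i` digits that
is zero. -/
def digitSet (B m a i : ℕ) : Set ℕ :=
  {x | ∃ j < i, a / B ^ j % B = 0 ∧ x = a + m * B ^ j}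

/-- Extend `A` by the numbers obtained from elements `≥ j` by replacing a zero digit by `m`. -/
def giveSet (B m k : ℕ) (A : Set ℕ) (j : ℕ) : Set ℕ :=
  A ∪ {x | ∃ a ∈ A, j ≤ a ∧ x ∈ digitSet B m a k}

theorem digitSet_zero (B m a : ℕ) : digitSet B m a 0 = ∅ := by simp [digitSet]

theorem digitSet_succ_pos {B m a i : ℕ} (h : a / B ^ i % B ≠ 0) :
    digitSet B m a (i + 1) = digitSet B m a i := by
  ext x; constructor
  · rintro ⟨j, hj, h0, hx⟩
    rcases Nat.lt_succ_iff_lt_or_eq.1 hj with hj | rfl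
    · exact ⟨j, hj, h0, hx⟩
    · exact absurd h0 h
  · rintro ⟨j, hj, h⟩; exact ⟨j, by omega, h⟩

theorem digitSet_succ_zero {B m a i : ℕ} (h : a / B ^ i % B = 0) :
    digitSet B m a (i + 1) = insert (a + m * B ^ i) (digitSet B m a i) := by
  ext x; constructor
  · rintro ⟨j, hj, h0, hx⟩
    rcases Nat.lt_succ_iff_lt_or_eq.1 hj with hj | rfl
    · exact Or.inr ⟨j, hj, h0, hx⟩
    · exact Or.inl hx
  · rintro (rfl | ⟨j, hj, h⟩)
    · exact ⟨i, by omega, h, rfl⟩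
    · exact ⟨j, by omega, h⟩

/-- One step of the enumeration of the digits of a number `a`: if the current digit (of the number
in register `2`) is zero, mark the cell whose distance from that of `a` is in register `3`. -/
def digitStep : Prog :=
  .seq divProg (.seq (.add 4 0 rZero) (.seq (.ifPos 2 .nop (.seq (.add 1 9 3) (.store 1 rOne)))
    (.seq (mulProg rB 3) (.seq (.add 3 0 rZero) (.add 2 4 rZero)))))

/-- With `a / B ^ i` in register `2` the next digit is a remainder modulo `B`, and putting `m` in
place of a zero digit moves the cell by `m * B ^ i`. The hypothesis `hno` keeps the marked cell
inside the same table. -/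
theorem runs_digitStep {W B N X w a m i : ℕ} {d : ℤ} {inp : ℕ → ℤ} {par sz : ℕ → ℕ}
    {F : ℕ → Set ℕ} {s : State} {A : Set ℕ} (henv : Env W B N X d s) (hw : w < B) (ha : a < N)
    (hm : m < B)
    (hi : B ^ (i + 1) ≤ N) (h9 : s.reg 9 = (X + 2 * B + w * N + a : ℕ))
    (h2 : s.reg 2 = (a / B ^ i : ℕ)) (h3 : s.reg 3 = (m * B ^ i : ℕ))
    (hno : a / B ^ i % B = 0 → a + m * B ^ i < N)
    (hmem : s.mem = memOf B N X inp par sz (Function.update F w (A ∪ digitSet B m a i))) :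
    Runs W digitStep s (4 * N + 3 * B + 14) (fun s' => Frame 8 s s' ∧
      s'.reg 2 = (a / B ^ (i + 1) : ℕ) ∧ s'.reg 3 = (m * B ^ (i + 1) : ℕ) ∧
      s'.mem = memOf B N X inp par sz (Function.update F w (A ∪ digitSet B m a (i + 1)))) := by
  have hword := henv.word
  have hBN : N ≤ B * N := Nat.le_mul_of_pos_left N henv.base_pos
  have hBB : B ≤ B * N := Nat.le_mul_of_pos_right B henv.len_pos
  have hwN : w * N + N ≤ B * N := by
    calc w * N + N = (w + 1) * N := by ring
      _ ≤ B * N := Nat.mul_le_mul_right N hw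
  have hdle : a / B ^ i ≤ a := Nat.div_le_self _ _
  -- The shift for the next digit is computed even after the last digit, where it may exceed `N`; it
  -- only has to be a word.
  have hMB : m * B ^ (i + 1) ≤ B * N := Nat.mul_le_mul hm.le hi
  have hM : m * B ^ i ≤ B * N :=
    le_trans (Nat.mul_le_mul_left m (Nat.pow_le_pow_right henv.base_pos (Nat.le_succ i))) hMB
  have hdd : a / B ^ i / B ≤ a / B ^ i := Nat.div_le_self _ _
  have hWz : (X : ℤ) + 4 * B + 4 * (B * N : ℕ) ≤ W := by exact_mod_cast (by omega)
  unfold digitStep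
  refine Runs.seq (runs_divProg henv.one henv.base henv.base_pos h2 (by omega))
    (T₂ := 3 * B + 10) (by omega) ?_
  rintro s₁ ⟨hF₁, h0₁, h2₁, hm₁⟩
  have henv₁ := henv.frame hF₁ (by norm_num)
  refine Runs.seq_add (T := 3 * B + 9) ?_ ?_
  · rw [henv₁.zero, h0₁, add_zero, Nat.abs_cast]; exact_mod_cast (by omega)
  rw [henv₁.zero, h0₁, add_zero]
  refine Runs.seq (T₁ := 3) (T₂ := 3 * B + 6) (R := fun s' => Frame 8 s s' ∧
      s'.reg 4 = (a / B ^ (i + 1) : ℕ) ∧ s'.reg 3 = (m * B ^ i : ℕ) ∧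
      s'.mem = memOf B N X inp par sz (Function.update F w (A ∪ digitSet B m a (i + 1))))
    ?_ (by omega) ?_
  · have hdiv : a / B ^ i / B = a / B ^ (i + 1) := by rw [Nat.div_div_eq_div_mul, pow_succ]
    have hFr : Frame 8 s (s₁.setReg 4 (a / B ^ i / B : ℕ)) :=
      (hF₁.mono (by norm_num)).setReg (by norm_num)
    have h3₁ : s₁.reg 3 = (m * B ^ i : ℕ) := (hF₁ 3 le_rfl).trans h3
    have h9₁ : s₁.reg 9 = (X + 2 * B + w * N + a : ℕ) := (hF₁ 9 (by norm_num)).trans h9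
    refine Runs.ifPos (T := 2) (fun hpos => ?_) (fun hneg => ?_)
    · simp only [State.reg_setReg] at hpos
      norm_num only [if_false] at hpos
      rw [h2₁, Nat.cast_pos] at hpos
      refine Runs.nop ⟨hFr, by simp [State.reg_setReg, hdiv], by simpa [State.reg_setReg] using h3₁, ?_⟩
      rw [digitSet_succ_pos hpos.ne']
      simpa [hm₁] using hmem
    · simp only [State.reg_setReg] at hneg
      norm_num only [if_false] at hneg
      rw [h2₁] at hneg
      have hz : a / B ^ i % B = 0 := by exact_mod_cast le_antisymm hneg (Nat.cast_nonneg _)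
      have hlt := hno hz
      have e : (s₁.reg 9 + s₁.reg 3) = (X + 2 * B + w * N + (a + m * B ^ i) : ℕ) := by
        rw [h9₁, h3₁]; push_cast; ring
      refine Runs.seq_add ?_ (Runs.store (T := 0) (a := X + 2 * B + w * N + (a + m * B ^ i)) ?_ ?_)
      · simp only [State.reg_setReg]; norm_num only [if_true, if_false]
        rw [e, Nat.abs_cast]; exact_mod_cast (by omega)
      · simp only [State.reg_setReg]; norm_num only [if_true, if_false]
        rw [e]
      · refine ⟨(hFr.setReg (by norm_num)).setMem, by simp [State.reg_setReg, hdiv],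
          by simpa [State.reg_setReg] using h3₁, ?_⟩
        have h1 : s₁.reg rOne = 1 := henv₁.one
        simp only [State.mem_setMem, State.mem_setReg, State.reg_setReg]
        norm_num only [if_true, if_false]
        rw [h1, hm₁, hmem, update_memOf_table hlt, digitSet_succ_zero hz]
        simp [Set.union_insert]
  · rintro s₂ ⟨hF₂, h4₂, h3₂, hm₂⟩
    have henv₂ := henv.frame hF₂ (by norm_num)
    refine Runs.seq (runs_mulProg (by norm_num) (by norm_num) henv₂.one henv₂.zero henv₂.base h3₂
      (by rw [show B * (m * B ^ i) = m * B ^ (i + 1) by ring]; omega) (by omega)) (T₂ := 2)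
      (by omega) ?_
    rintro s₃ ⟨hF₃, h0₃, hm₃⟩
    have henv₃ := henv₂.frame hF₃ (by norm_num)
    have h4₃ : s₃.reg 4 = (a / B ^ (i + 1) : ℕ) := (hF₃ 4 (by norm_num)).trans h4₂
    rw [show B * (m * B ^ i) = m * B ^ (i + 1) by ring] at h0₃
    have hdle' : a / B ^ (i + 1) ≤ a := Nat.div_le_self _ _
    refine Runs.seq_add ?_ (Runs.add (T := 0) ?_ ⟨?_, ?_, ?_, ?_⟩)
    · rw [henv₃.zero, h0₃, add_zero, Nat.abs_cast]; exact_mod_cast (by omega)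
    · simp only [State.reg_setReg]; norm_num only [if_true, if_false]
      rw [henv₃.zero, h4₃, add_zero, Nat.abs_cast]; exact_mod_cast (by omega)
    · exact ((hF₂.trans (hF₃.mono (by norm_num))).setReg (by norm_num)).setReg (by norm_num)
    · simp only [State.reg_setReg]; norm_num only [if_true, if_false]
      rw [henv₃.zero, h4₃, add_zero]
    · simp only [State.reg_setReg]; norm_num only [if_true, if_false]
      rw [henv₃.zero, h0₃, add_zero]
    · simp [hm₃, hm₂]

theorem giveSet_of_lt {B m k N : ℕ} {A : Set ℕ} (h : ∀ a ∈ A, a < N) : giveSet B m k A N = A := by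
  ext x; constructor
  · rintro (hx | ⟨a, ha, hN, -⟩)
    · exact hx
    · exact absurd (h a ha) (by omega)
  · exact Or.inl

theorem giveSet_of_mem {B m k j : ℕ} {A : Set ℕ} (h : j ∈ A) :
    giveSet B m k A j = giveSet B m k A (j + 1) ∪ digitSet B m j k := by
  ext x; constructor
  · rintro (hx | ⟨a, ha, hj, hx⟩)
    · exact Or.inl (Or.inl hx)
    · rcases hj.eq_or_lt with rfl | hj
      · exact Or.inr hx
      · exact Or.inl (Or.inr ⟨a, ha, hj, hx⟩)
  · rintro ((hx | ⟨a, ha, hj, hx⟩) | hx)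
    · exact Or.inl hx
    · exact Or.inr ⟨a, ha, by omega, hx⟩
    · exact Or.inr ⟨j, h, le_rfl, hx⟩

theorem giveSet_of_notMem {B m k j : ℕ} {A : Set ℕ} (h : j ∉ A) :
    giveSet B m k A j = giveSet B m k A (j + 1) := by
  ext x; constructor
  · rintro (hx | ⟨a, ha, hj, hx⟩)
    · exact Or.inl hx
    · rcases hj.eq_or_lt with rfl | hj
      · exact absurd ha h
      · exact Or.inr ⟨a, ha, hj, hx⟩
  · rintro (hx | ⟨a, ha, hj, hx⟩)
    · exact Or.inl hx
    · exact Or.inr ⟨a, ha, by omega, hx⟩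

/-- This makes the update in place correct: numbers produced from elements above `j` are themselves
above `j`, so entry `j` is still the original one when the downward scan reaches it. -/
theorem mem_giveSet_succ {B m k j : ℕ} {A : Set ℕ} : j ∈ giveSet B m k A (j + 1) ↔ j ∈ A := by
  constructor
  · rintro (hx | ⟨a, ha, hj, i, hi, h0, hx⟩)
    · exact hx
    · omega
  · exact Or.inl

/-- Give the item to one of the agents: extend the table at the address in register `20` by the
numbers in which a zero digit has been replaced by the number in register `23`. -/
def giveProg (k : ℕ) : Prog :=
  forDown 10 (.seq (.add 9 20 10) (.seq (.load 5 9) (.ifPos 5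
    (.seq (.add 2 10 rZero) (.seq (.add 3 23 rZero) (.seq (.const 8 k) (forDown 8 digitStep))))
    .nop)))

theorem runs_giveProg {k W B N X w m : ℕ} {d : ℤ} {inp : ℕ → ℤ} {par sz : ℕ → ℕ}
    {F : ℕ → Set ℕ} {s : State} (henv : Env W B N X d s) (hw : w < B) (hmB : m < B)
    (hkW : k ≤ W) (hN : B ^ k ≤ N) (hF : ∀ a ∈ F w, a < N)
    (hno : ∀ a ∈ F w, ∀ i < k, a / B ^ i % B = 0 → a + m * B ^ i < N)
    (h10 : s.reg 10 = N) (h20 : s.reg 20 = (X + 2 * B + w * N : ℕ)) (h23 : s.reg 23 = m)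
    (hmem : s.mem = memOf B N X inp par sz F) :
    Runs W (giveProg k) s (N * (k * (4 * N + 3 * B + 16) + 9) + 1) (fun s' => Frame 11 s s' ∧
      s'.mem = memOf B N X inp par sz (Function.update F w (giveSet B m k (F w) 0))) := by
  have hword := henv.word
  have hBN : N ≤ B * N := Nat.le_mul_of_pos_left N henv.base_pos
  have hBB : B ≤ B * N := Nat.le_mul_of_pos_right B henv.len_pos
  have hwN : w * N + N ≤ B * N := by
    calc w * N + N = (w + 1) * N := by ring
      _ ≤ B * N := Nat.mul_le_mul_right N hw
  unfold giveProg
  refine Runs.forDown (m := N) (fun j s' => s'.mem = memOf B N X inp par sz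
    (Function.update F w (giveSet B m k (F w) j))) (by norm_num) henv.one h10 (by omega) ?_
    (fun _ _ _ h => h) ?_
  · rw [giveSet_of_lt hF, Function.update_eq_self, hmem]
  intro a ha s₁ hF₁ h10₁ hm₁
  have henv₁ := henv.frame hF₁ (by norm_num)
  have h20₁ : s₁.reg 20 = (X + 2 * B + w * N : ℕ) := (hF₁ 20 (by norm_num)).trans h20
  have h23₁ : s₁.reg 23 = m := (hF₁ 23 (by norm_num)).trans h23
  have e : s₁.reg 20 + s₁.reg 10 = (X + 2 * B + w * N + a : ℕ) := by
    rw [h20₁, h10₁]; push_cast; ring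
  refine Runs.seq_add (T := k * (4 * N + 3 * B + 16) + 6) ?_
    (Runs.seq_load (a := X + 2 * B + w * N + a) ?_ (Runs.ifPos (fun hpos => ?_) (fun hneg => ?_)))
  · rw [e, Nat.abs_cast]; exact_mod_cast (by omega)
  · simp only [State.reg_setReg]; norm_num only [if_true]
    rw [e]
  · simp only [State.reg_setReg, State.mem_setReg] at hpos
    norm_num only [if_true] at hpos
    rw [hm₁, memOf_table_pos ha, Function.update_self, mem_giveSet_succ] at hpos
    have hWz : (m : ℤ) ≤ W := by exact_mod_cast (by omega)
    have hWz' : (a : ℤ) ≤ W := by exact_mod_cast (by omega)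
    refine Runs.seq_add ?_ (Runs.seq_add ?_ (Runs.seq_const ?_ ?_))
    · simp only [State.reg_setReg]; norm_num only [if_false]
      rw [henv₁.zero, h10₁, add_zero, Nat.abs_cast]; exact hWz'
    · simp only [State.reg_setReg]; norm_num only [if_false]
      rw [henv₁.zero, h23₁, add_zero, Nat.abs_cast]; exact hWz
    · rw [Nat.abs_cast]; exact_mod_cast hkW
    set s₂ := State.setReg _ 8 _ with hs₂
    have hF₂ : Frame 10 s₁ s₂ := by
      rw [hs₂]
      exact (((((Frame.refl _ _).setReg (by norm_num)).setReg (by norm_num)).setReg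
        (by norm_num)).setReg (by norm_num)).setReg (by norm_num)
    have henv₂ := henv₁.frame hF₂ (by norm_num)
    have h8₂ : s₂.reg 8 = k := by simp [hs₂, State.reg_setReg]
    have h2₂ : s₂.reg 2 = a := by simp [hs₂, State.reg_setReg, h10₁, henv₁.zero]
    have h3₂ : s₂.reg 3 = m := by simp [hs₂, State.reg_setReg, h23₁, henv₁.zero]
    have h9₂ : s₂.reg 9 = (X + 2 * B + w * N + a : ℕ) := by simp [hs₂, State.reg_setReg, e]
    have hm₂ : s₂.mem = s₁.mem := by simp [hs₂]
    -- The counter runs down from `k`, so `k - j` is the number of digits already treated.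
    refine Runs.mono (Runs.forDown (m := k) (C := 4 * N + 3 * B + 14) (fun j s' =>
      s'.reg 2 = (a / B ^ (k - j) : ℕ) ∧ s'.reg 3 = (m * B ^ (k - j) : ℕ) ∧
      s'.mem = memOf B N X inp par sz (Function.update F w
        (giveSet B m k (F w) (a + 1) ∪ digitSet B m a (k - j))))
      (by norm_num) henv₂.one h8₂ hkW ⟨by simp [h2₂], by simp [h3₂], ?_⟩ ?_ ?_) le_rfl ?_
    · simp [digitSet_zero, hm₂, hm₁]
    · rintro j s' v ⟨h2, h3, hm⟩
      exact ⟨by simpa [State.reg_setReg] using h2, by simpa [State.reg_setReg] using h3, hm⟩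
    · rintro j hj s₃ hF₃ - ⟨h2, h3, hm⟩
      have hkj : k - j = k - (j + 1) + 1 := by omega
      rw [hkj]
      exact runs_digitStep (henv₂.frame hF₃ (by norm_num)) hw ha hmB
        ((Nat.pow_le_pow_right henv.base_pos (by omega)).trans hN)
        ((hF₃ 9 (by norm_num)).trans h9₂) h2 h3 (hno a hpos _ (by omega)) hm
    · rintro s₃ ⟨hF₃, -, -, hm⟩
      refine ⟨hF₂.trans (hF₃.mono (by norm_num)), ?_⟩
      rw [hm, giveSet_of_mem hpos]; rfl
  · simp only [State.reg_setReg, State.mem_setReg] at hneg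
    norm_num only [if_true] at hneg
    rw [← not_lt, hm₁, memOf_table_pos ha, Function.update_self, mem_giveSet_succ] at hneg
    refine Runs.nop ⟨((Frame.refl _ _).setReg (by norm_num)).setReg (by norm_num), ?_⟩
    rw [giveSet_of_notMem hneg]; exact hm₁

/-! ### Adding the vectors of a subtree to those of its parent -/

/-- Extend `A` by the sums of its elements `≥ j` and the elements of `C`. -/
def sumSet (A C : Set ℕ) (j : ℕ) : Set ℕ :=
  A ∪ {x | ∃ c ∈ A, j ≤ c ∧ ∃ a ∈ C, x = c + a}

theorem sumSet_of_lt {N : ℕ} {A C : Set ℕ} (h : ∀ a ∈ A, a < N) : sumSet A C N = A := by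
  ext x; constructor
  · rintro (hx | ⟨a, ha, hN, -⟩)
    · exact hx
    · exact absurd (h a ha) (by omega)
  · exact Or.inl

/-- The vacuous clause `0 ≤ a` gives the right side the form of the inner loop's invariant at the
end of that loop. -/
theorem sumSet_of_mem {j : ℕ} {A C : Set ℕ} (h : j ∈ A) :
    sumSet A C j = sumSet A C (j + 1) ∪ {x | ∃ a ∈ C, 0 ≤ a ∧ x = j + a} := by
  ext x; constructor
  · rintro (hx | ⟨c, hc, hj, a, ha, hx⟩)
    · exact Or.inl (Or.inl hx)
    · rcases hj.eq_or_lt with rfl | hj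
      · exact Or.inr ⟨a, ha, Nat.zero_le a, hx⟩
      · exact Or.inl (Or.inr ⟨c, hc, hj, a, ha, hx⟩)
  · rintro ((hx | ⟨c, hc, hj, hx⟩) | ⟨a, ha, -, hx⟩)
    · exact Or.inl hx
    · exact Or.inr ⟨c, hc, by omega, hx⟩
    · exact Or.inr ⟨j, h, le_rfl, a, ha, hx⟩

theorem sumSet_of_notMem {j : ℕ} {A C : Set ℕ} (h : j ∉ A) :
    sumSet A C j = sumSet A C (j + 1) := by
  ext x; constructor
  · rintro (hx | ⟨c, hc, hj, hx⟩)
    · exact Or.inl hx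
    · rcases hj.eq_or_lt with rfl | hj
      · exact absurd hc h
      · exact Or.inr ⟨c, hc, hj, hx⟩
  · rintro (hx | ⟨c, hc, hj, hx⟩)
    · exact Or.inl hx
    · exact Or.inr ⟨c, hc, by omega, hx⟩

/-- As for `giveSet`: a sum with first summand above `j` is above `j`, so the scan reads original
entries. -/
theorem mem_sumSet_succ {j : ℕ} {A C : Set ℕ} : j ∈ sumSet A C (j + 1) ↔ j ∈ A := by
  constructor
  · rintro (hx | ⟨c, hc, hj, a, ha, hx⟩)
    · exact hx
    · omega
  · exact Or.inl

/-- Mark a sum if the second summand, in register `10`, is in the table. -/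
def sumStep : Prog :=
  .seq (.add 5 20 10) (.seq (.load 5 5) (.ifPos 5 (.seq (.add 5 11 10) (.store 5 rOne)) .nop))

/-- Extend the table at the address in register `19` by the sums of its elements and those of the
table at the address in register `20`. -/
def sumProg : Prog :=
  forDown 12 (.seq (.add 11 19 12) (.seq (.load 5 11) (.ifPos 5
    (.seq (.add 10 rL rZero) (forDown 10 sumStep)) .nop)))

/-- Since `p ≠ w`, the table of second summands is constant during the loop; `hno` prevents sums
from running into the next table. -/
theorem runs_sumProg {W B N X w p : ℕ} {d : ℤ} {inp : ℕ → ℤ} {par sz : ℕ → ℕ}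
    {F : ℕ → Set ℕ} {s : State} (henv : Env W B N X d s) (hw : w < B) (hp : p < B) (hpw : p ≠ w)
    (hFw : ∀ a ∈ F w, a < N) (hFp : ∀ a ∈ F p, a < N)
    (hno : ∀ c ∈ F p, ∀ a ∈ F w, c + a < N)
    (h12 : s.reg 12 = N) (h19 : s.reg 19 = (X + 2 * B + p * N : ℕ))
    (h20 : s.reg 20 = (X + 2 * B + w * N : ℕ)) (hmem : s.mem = memOf B N X inp par sz F) :
    Runs W sumProg s (N * (7 * N + 7) + 1) (fun s' => Frame 13 s s' ∧
      s'.mem = memOf B N X inp par sz (Function.update F p (sumSet (F p) (F w) 0))) := by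
  have hword := henv.word
  have hBN : N ≤ B * N := Nat.le_mul_of_pos_left N henv.base_pos
  have hwN : w * N + N ≤ B * N := by
    calc w * N + N = (w + 1) * N := by ring
      _ ≤ B * N := Nat.mul_le_mul_right N hw
  have hpN : p * N + N ≤ B * N := by
    calc p * N + N = (p + 1) * N := by ring
      _ ≤ B * N := Nat.mul_le_mul_right N hp
  unfold sumProg
  refine Runs.forDown (m := N) (C := 7 * N + 5) (fun j s' => s'.mem = memOf B N X inp par sz
    (Function.update F p (sumSet (F p) (F w) j))) (by norm_num) henv.one h12 (by omega) ?_
    (fun _ _ _ h => h) ?_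
  · rw [sumSet_of_lt hFp, Function.update_eq_self, hmem]
  intro c hc s₁ hF₁ h12₁ hm₁
  have henv₁ := henv.frame hF₁ (by norm_num)
  have h20₁ : s₁.reg 20 = (X + 2 * B + w * N : ℕ) := (hF₁ 20 (by norm_num)).trans h20
  have h19₁ : s₁.reg 19 = (X + 2 * B + p * N : ℕ) := (hF₁ 19 (by norm_num)).trans h19
  have e : s₁.reg 19 + s₁.reg 12 = (X + 2 * B + p * N + c : ℕ) := by
    rw [h19₁, h12₁]; push_cast; ring
  refine Runs.seq_add ?_ (Runs.seq_load (a := X + 2 * B + p * N + c) ?_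
    (Runs.ifPos (T := 7 * N + 2) (fun hpos => ?_) (fun hneg => ?_)))
  · rw [e, Nat.abs_cast]; exact_mod_cast (by omega)
  · simp only [State.reg_setReg]; norm_num only [if_true]
    rw [e]
  · simp only [State.reg_setReg, State.mem_setReg] at hpos
    norm_num only [if_true] at hpos
    rw [hm₁, memOf_table_pos hc, Function.update_self, mem_sumSet_succ] at hpos
    refine Runs.seq_add ?_ ?_
    · simp only [State.reg_setReg]; norm_num only [if_false]
      rw [henv₁.zero, henv₁.len, add_zero, Nat.abs_cast]; exact_mod_cast (by omega)
    set s₂ := State.setReg _ 10 _ with hs₂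
    have hF₂ : Frame 12 s₁ s₂ := by
      rw [hs₂]
      exact (((Frame.refl _ _).setReg (by norm_num)).setReg (by norm_num)).setReg (by norm_num)
    have henv₂ := henv₁.frame hF₂ (by norm_num)
    have h10₂ : s₂.reg 10 = N := by simp [hs₂, State.reg_setReg, henv₁.len, henv₁.zero]
    have h11₂ : s₂.reg 11 = (X + 2 * B + p * N + c : ℕ) := by simp [hs₂, State.reg_setReg, e]
    have h20₂ : s₂.reg 20 = (X + 2 * B + w * N : ℕ) := (hF₂ 20 (by norm_num)).trans h20₁
    have hm₂ : s₂.mem = s₁.mem := by simp [hs₂]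
    refine Runs.mono (Runs.forDown (m := N) (C := 5) (fun j s' =>
      s'.mem = memOf B N X inp par sz (Function.update F p
        (sumSet (F p) (F w) (c + 1) ∪ {x | ∃ a ∈ F w, j ≤ a ∧ x = c + a})))
      (by norm_num) henv₂.one h10₂ (by omega) ?_ (fun _ _ _ h => h) ?_) (by omega) ?_
    · rw [hm₂, hm₁]
      congr 2
      rw [eq_comm, Set.union_eq_left]
      rintro x ⟨a, ha, hNa, -⟩
      exact absurd (hFw a ha) (by omega)
    · rintro a ha s₃ hF₃ h10₃ hm₃
      have henv₃ := henv₂.frame hF₃ (by norm_num)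
      have h11₃ : s₃.reg 11 = (X + 2 * B + p * N + c : ℕ) := (hF₃ 11 (by norm_num)).trans h11₂
      have h20₃ : s₃.reg 20 = (X + 2 * B + w * N : ℕ) := (hF₃ 20 (by norm_num)).trans h20₂
      have e₁ : s₃.reg 20 + s₃.reg 10 = (X + 2 * B + w * N + a : ℕ) := by
        rw [h20₃, h10₃]; push_cast; ring
      have e₂ : s₃.reg 11 + s₃.reg 10 = (X + 2 * B + p * N + (c + a) : ℕ) := by
        rw [h11₃, h10₃]; push_cast; ring
      refine Runs.seq_add ?_ (Runs.seq_load (a := X + 2 * B + w * N + a) ?_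
        (Runs.ifPos (fun hpos' => ?_) (fun hneg => ?_)))
      · rw [e₁, Nat.abs_cast]; exact_mod_cast (by omega)
      · simp only [State.reg_setReg]; norm_num only [if_true]
        rw [e₁]
      · simp only [State.reg_setReg, State.mem_setReg] at hpos'
        norm_num only [if_true] at hpos'
        rw [hm₃, memOf_table_pos ha, Function.update_of_ne hpw.symm] at hpos'
        have hlt := hno c hpos a hpos'
        refine Runs.seq_add ?_ (Runs.store (T := 0) (a := X + 2 * B + p * N + (c + a)) ?_ ?_)
        · simp only [State.reg_setReg]; norm_num only [if_false]
          rw [e₂, Nat.abs_cast]; exact_mod_cast (by omega)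
        · simp only [State.reg_setReg]; norm_num only [if_true, if_false]
          rw [e₂]
        · refine ⟨((((Frame.refl _ _).setReg (by norm_num)).setReg (by norm_num)).setReg
            (by norm_num)).setMem, ?_⟩
          have h1 : s₃.reg rOne = 1 := henv₃.one
          simp only [State.mem_setMem, State.mem_setReg, State.reg_setReg]
          norm_num only [if_false]
          rw [h1, hm₃, update_memOf_table hlt]
          congr 1
          rw [Function.update_self, Function.update_idem]
          congr 1
          ext x; constructor
          · rintro (rfl | hx | ⟨a', ha', hj, hx⟩)
            · exact Or.inr ⟨a, hpos', le_rfl, rfl⟩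
            · exact Or.inl hx
            · exact Or.inr ⟨a', ha', by omega, hx⟩
          · rintro (hx | ⟨a', ha', hj, hx⟩)
            · exact Or.inr (Or.inl hx)
            · rcases hj.eq_or_lt with rfl | hj
              · exact Or.inl hx
              · exact Or.inr (Or.inr ⟨a', ha', hj, hx⟩)
      · simp only [State.reg_setReg, State.mem_setReg] at hneg
        norm_num only [if_true] at hneg
        rw [← not_lt, hm₃, memOf_table_pos ha, Function.update_of_ne hpw.symm] at hneg
        refine Runs.nop ⟨((Frame.refl _ _).setReg (by norm_num)).setReg (by norm_num), ?_⟩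
        simp only [State.mem_setReg]
        rw [hm₃]
        congr 3
        ext x; constructor
        · rintro ⟨a', ha', hj, hx⟩; exact ⟨a', ha', by omega, hx⟩
        · rintro ⟨a', ha', hj, hx⟩
          rcases hj.eq_or_lt with rfl | hj
          · exact absurd ha' hneg
          · exact ⟨a', ha', hj, hx⟩
    · rintro s₃ ⟨hF₃, hm⟩
      refine ⟨hF₂.trans (hF₃.mono (by norm_num)), ?_⟩
      rw [hm, sumSet_of_mem hpos]
  · simp only [State.reg_setReg, State.mem_setReg] at hneg
    norm_num only [if_true] at hneg
    rw [← not_lt, hm₁, memOf_table_pos hc, Function.update_self, mem_sumSet_succ] at hneg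
    refine Runs.nop ⟨((Frame.refl _ _).setReg (by norm_num)).setReg (by norm_num), ?_⟩
    rw [sumSet_of_notMem hneg]; exact hm₁

/-! ### Out-forests -/

section Forest

open Relation

theorem isPath_singleton {V : Type*} {G : Digraph V} (v : V) : IsPath G v v [v] := by
  simp [IsPath]

/-- In an acyclic graph a walk cannot repeat a vertex. The induction carries along that all vertices
of the path reach its end, so a repeated new endpoint would close a cycle. -/
theorem exists_isPath {V : Type*} {G : Digraph V} {u v : V} (hG : IsAcyclic G)
    (h : ReflTransGen G.Adj u v) :
    ∃ p, IsPath G u v p ∧ ∀ x ∈ p, ReflTransGen G.Adj x v := by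
  induction h with
  | refl => exact ⟨[u], isPath_singleton u, by simp [ReflTransGen.refl]⟩
  | @tail b c hub hbc ih =>
    obtain ⟨p, ⟨h1, h2, h3, h4⟩, hp⟩ := ih
    have hc : c ∉ p := fun hc => hG c (TransGen.tail' (hp c hc) hbc)
    refine ⟨p ++ [c], ⟨?_, by simp, ?_, ?_⟩, ?_⟩
    · simp [h1]
    · rw [List.isChain_append]
      refine ⟨h3, by simp, fun x hx y hy => ?_⟩
      rw [h2] at hx
      simp at hx hy
      subst hx hy; exact hbc
    · rw [List.nodup_append]
      exact ⟨h4, by simp, fun a ha b hb => by simp at hb; subst hb; exact fun h => hc (h ▸ ha)⟩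
    · intro x hx
      rcases List.mem_append.1 hx with hx | hx
      · exact (hp x hx).tail hbc
      · simp at hx; subst hx; exact .refl

theorem IsPath.reflTransGen {V : Type*} {G : Digraph V} {v : V} :
    ∀ {p : List V} {u : V}, IsPath G u v p → ReflTransGen G.Adj u v
  | [], u, h => by simp [IsPath] at h
  | [a], u, h => by
    obtain ⟨h1, h2, -, -⟩ := h
    simp at h1 h2; subst h1 h2; exact .refl
  | a :: b :: p, u, h => by
    obtain ⟨h1, h2, h3, h4⟩ := h
    simp at h1; subst h1
    rw [List.isChain_cons_cons] at h3
    exact ReflTransGen.head h3.1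
      (IsPath.reflTransGen (p := b :: p) ⟨by simp, by simpa using h2, h3.2, h4.of_cons⟩)

theorem dominates_iff {V : Type*} {G : Digraph V} (hG : IsAcyclic G) {v u : V} :
    Dominates G v u ↔ ReflTransGen G.Adj v u :=
  ⟨fun ⟨_, h⟩ => h.reflTransGen, fun h => (exists_isPath hG h).imp fun _ h => h.1⟩

theorem IsOutForest.isAcyclic {V : Type*} {G : Digraph V} (h : IsOutForest G) : IsAcyclic G := by
  obtain ⟨c, hc, ht⟩ := h
  intro v hv
  -- Arcs never leave a class, so a closed walk at `v` lifts to the out-tree induced on the class of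
  -- `v`.
  have key : ∀ u, TransGen G.Adj v u → ∃ hu : c v u,
      TransGen (induce G {x | c v x}).Adj ⟨v, c.refl v⟩ ⟨u, hu⟩ := by
    intro u hu
    induction hu with
    | single h => exact ⟨hc _ _ h, .single h⟩
    | tail _ h ih =>
      obtain ⟨h1, h2⟩ := ih
      exact ⟨c.trans h1 (hc _ _ h), h2.tail h⟩
  obtain ⟨_, h2⟩ := key v hv
  exact (ht v).1 _ h2

/-- Each parent of `v` extends a path from the root to a path ending in `v`. The two extended paths
coincide by uniqueness, and so do their last vertices before `v`. An arc into the root would close a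
cycle, so `v` is not the root. -/
theorem IsOutTree.adj_unique {V : Type*} {G : Digraph V} (h : IsOutTree G) {u u' v : V}
    (hu : G.Adj u v) (hu' : G.Adj u' v) : u = u' := by
  obtain ⟨hac, r, hr⟩ := h
  have reach : ∀ w, ReflTransGen G.Adj r w := fun w => by
    by_cases hw : w = r
    · subst hw; exact .refl
    · exact (hr w hw).exists.choose_spec.reflTransGen
  have hv : v ≠ r := by
    rintro rfl
    exact hac _ (TransGen.tail' (reach u) hu)
  have key : ∀ w, G.Adj w v → ∃ p, IsPath G r w p ∧ IsPath G r v (p ++ [v]) := by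
    intro w hw
    obtain ⟨p, ⟨h1, h2, h3, h4⟩, hp⟩ := exists_isPath hac (reach w)
    have hvp : v ∉ p := fun hc => hac v (TransGen.tail' (hp v hc) hw)
    refine ⟨p, ⟨h1, h2, h3, h4⟩, by simp [h1], by simp, ?_, ?_⟩
    · rw [List.isChain_append]
      refine ⟨h3, by simp, fun x hx y hy => ?_⟩
      rw [h2] at hx
      simp at hx hy
      subst hx hy; exact hw
    · rw [List.nodup_append]
      exact ⟨h4, by simp, fun a ha b hb => by simp at hb; subst hb; exact fun h => hvp (h ▸ ha)⟩
  obtain ⟨p, hp, hpv⟩ := key u hu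
  obtain ⟨p', hp', hpv'⟩ := key u' hu'
  have := (hr v hv).unique hpv hpv'
  rw [List.append_cancel_right_eq] at this
  subst this
  have := hp.2.1.symm.trans hp'.2.1
  simpa using this

theorem IsOutForest.adj_unique {V : Type*} {G : Digraph V} (h : IsOutForest G) {u u' v : V}
    (hu : G.Adj u v) (hu' : G.Adj u' v) : u = u' := by
  obtain ⟨c, hc, ht⟩ := h
  have h1 : c v u := c.symm (hc _ _ hu)
  have h2 : c v u' := c.symm (hc _ _ hu')
  have := (ht v).adj_unique (u := ⟨u, h1⟩) (u' := ⟨u', h2⟩) (v := ⟨v, c.refl v⟩) hu hu'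
  simpa using this

variable {n : ℕ} {G : Digraph (Fin n)}

/-- Walking backwards from `x` is deterministic because parents are unique, so all ancestors of `x`
lie on one chain. -/
theorem IsOutForest.comparable (h : IsOutForest G) {u v x : Fin n} (hu : ReflTransGen G.Adj u x)
    (hv : ReflTransGen G.Adj v x) : ReflTransGen G.Adj u v ∨ ReflTransGen G.Adj v u := by
  have := ReflTransGen.total_of_right_unique (r := Function.swap G.Adj)
    (fun a b c hb hc => h.adj_unique hb hc) (reflTransGen_swap.2 hu) (reflTransGen_swap.2 hv)
  exact this.symm.imp reflTransGen_swap.1 reflTransGen_swap.1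

theorem IsOutForest.exists_minimal (h : IsOutForest G) (S : Set (Fin n)) (hS : S.Nonempty) :
    ∃ m ∈ S, ∀ u ∈ S, ReflTransGen G.Adj u m → u = m := by
  have : Std.Irrefl (TransGen G.Adj) := ⟨h.isAcyclic⟩
  have hwf : WellFounded (TransGen G.Adj) := Finite.wellFounded_of_trans_of_irrefl _
  obtain ⟨m, hm, hmin⟩ := hwf.has_min S hS
  refine ⟨m, hm, fun u hu hum => ?_⟩
  rcases reflTransGen_iff_eq_or_transGen.1 hum with e | e
  · exact e.symm
  · exact absurd e (hmin u hu)

open Classical in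
/-- The items dominated by `v`. -/
noncomputable def subtree (G : Digraph (Fin n)) (v : Fin n) : Finset (Fin n) :=
  Finset.univ.filter (ReflTransGen G.Adj v)

@[simp] theorem mem_subtree {u v : Fin n} : u ∈ subtree G v ↔ ReflTransGen G.Adj v u := by
  simp [subtree]

theorem card_subtree_pos (v : Fin n) : 0 < (subtree G v).card :=
  Finset.card_pos.2 ⟨v, by simp [ReflTransGen.refl]⟩

theorem card_subtree_le (v : Fin n) : (subtree G v).card ≤ n := by
  simpa using (subtree G v).card_le_univ

/-- Subtree size thus gives an order in which all children precede their parent. -/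
theorem IsOutForest.card_subtree_lt (h : IsOutForest G) {u v : Fin n} (huv : G.Adj u v) :
    (subtree G v).card < (subtree G u).card := by
  refine Finset.card_lt_card ⟨fun x hx => ?_, fun hs => ?_⟩
  · rw [mem_subtree] at *; exact hx.head huv
  · have : ReflTransGen G.Adj v u := mem_subtree.1 (hs (mem_subtree.2 .refl))
    exact h.isAcyclic u (TransGen.head' huv this)

/-! ### Allocations as colourings -/

variable {k : ℕ}

/-- No agent gets an item and another one that is dominated by it. -/
def IsValid (G : Digraph (Fin n)) (f : Fin n → Option (Fin k)) : Prop :=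
  ∀ u v i, f u = some i → f v = some i → ReflTransGen G.Adj u v → u = v

/-- The number of items dominated by the items of agent `i`, if the colouring is valid. -/
noncomputable def score (G : Digraph (Fin n)) (f : Fin n → Option (Fin k)) (i : Fin k) : ℕ :=
  ∑ v, if f v = some i then (subtree G v).card else 0

/-- The encoding of the vector of scores as a number with base `n + 1`. -/
noncomputable def code (G : Digraph (Fin n)) (f : Fin n → Option (Fin k)) : ℕ :=
  ∑ v, (f v).elim 0 fun i => (subtree G v).card * (n + 1) ^ (i : ℕ)

theorem code_eq (f : Fin n → Option (Fin k)) :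
    code G f = ∑ i : Fin k, score G f i * (n + 1) ^ (i : ℕ) := by
  unfold code score
  simp_rw [Finset.sum_mul]
  rw [Finset.sum_comm]
  refine Finset.sum_congr rfl fun v _ => ?_
  cases hv : f v with
  | none => simp
  | some i => simp [ite_mul]

/-- An item below two items of one agent would make them comparable, which validity excludes; so the
subtrees are disjoint and their sizes add up. -/
theorem score_eq_card (h : IsOutForest G) {f : Fin n → Option (Fin k)} (hf : IsValid G f)
    (i : Fin k) : score G f i = {u | ∃ v, f v = some i ∧ ReflTransGen G.Adj v u}.ncard := by
  classical
  have e : {u | ∃ v, f v = some i ∧ ReflTransGen G.Adj v u} =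
      ((Finset.univ.filter (fun v => f v = some i)).biUnion (subtree G) : Finset (Fin n)) := by
    ext u; simp
  rw [e, Set.ncard_coe_finset, Finset.card_biUnion, score, Finset.sum_filter]
  intro u hu v hv huv
  rw [Function.onFun, Finset.disjoint_left]
  intro x hxu hxv
  rw [mem_subtree] at hxu hxv
  simp at hu hv
  rcases h.comparable hxu hxv with h' | h'
  · exact huv (hf u v i hu hv h')
  · exact huv (hf v u i hv hu h').symm

theorem score_le (h : IsOutForest G) {f : Fin n → Option (Fin k)} (hf : IsValid G f)
    (i : Fin k) : score G f i ≤ n := by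
  rw [score_eq_card h hf]
  simpa using Set.ncard_le_card {u | ∃ v, f v = some i ∧ ReflTransGen G.Adj v u}

/-- Scores of a valid colouring are at most `n`, hence genuine digits in base `n + 1`. The upper
bound is what keeps every table within `(n + 1) ^ k` cells. -/
theorem code_digit_and_lt (h : IsOutForest G) {f : Fin n → Option (Fin k)} (hf : IsValid G f) :
    (∀ i : Fin k, code G f / (n + 1) ^ (i : ℕ) % (n + 1) = score G f i) ∧
      code G f < (n + 1) ^ k := by
  let g : Fin k → Fin (n + 1) := fun i => ⟨score G f i, Nat.lt_succ_of_le (score_le h hf i)⟩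
  have e : code G f = (finFunctionFinEquiv g : ℕ) := by
    rw [finFunctionFinEquiv_apply, code_eq]
  refine ⟨fun i => ?_, e ▸ (finFunctionFinEquiv g).2⟩
  have := congr_fun (finFunctionFinEquiv.symm_apply_apply g) i
  rw [e]
  exact congr_arg Fin.val this

/-- Only the dominated set enters the dissatisfaction, so the bundle `a i` need not be the colour
class of `i`; it suffices that both dominate the same items. -/
theorem dissatisfaction_add_score (h : IsOutForest G) {f : Fin n → Option (Fin k)}
    (hf : IsValid G f) {a : Fin k → Set (Fin n)} {i : Fin k}
    (ha : ∀ u, (∃ v ∈ a i, ReflTransGen G.Adj v u) ↔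
      ∃ v, f v = some i ∧ ReflTransGen G.Adj v u) :
    dissatisfaction G a i + score G f i = n := by
  rw [score_eq_card h hf, dissatisfaction]
  simp_rw [dominates_iff h.isAcyclic, ha]
  have := Set.ncard_add_ncard_compl {u | ∃ v, f v = some i ∧ ReflTransGen G.Adj v u}
  rw [Nat.card_fin] at this
  rw [add_comm]
  exact this

theorem minMaxDissatisfaction_iff (h : IsOutForest G) (d : ℤ) :
    MinMaxDissatisfaction k G d ↔
      ∃ f : Fin n → Option (Fin k), IsValid G f ∧ ∀ i, (n : ℤ) ≤ score G f i + d := by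
  classical
  constructor
  · rintro ⟨a, ha, hd⟩
    -- Keep of each bundle only the items that no other item of the bundle dominates; every
    -- dominated item is still dominated by one of these.
    let top : Fin k → Set (Fin n) := fun i =>
      {v | v ∈ a i ∧ ∀ u ∈ a i, ReflTransGen G.Adj u v → u = v}
    let f : Fin n → Option (Fin k) := fun v =>
      if hv : ∃ i, v ∈ top i then some hv.choose else none
    have hf : ∀ v i, f v = some i ↔ v ∈ top i := by
      intro v i
      by_cases hv : ∃ i, v ∈ top i
      · have e : f v = some hv.choose := dif_pos hv
        rw [e, Option.some_inj]
        constructor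
        · rintro rfl; exact hv.choose_spec
        · intro hi
          by_contra hne
          exact Set.disjoint_left.1 (ha _ _ hne) hv.choose_spec.1 hi.1
      · have e : f v = none := dif_neg hv
        rw [e]
        constructor
        · rintro ⟨⟩
        · intro hi; exact absurd ⟨i, hi⟩ hv
    have hval : IsValid G f := fun u v i hu hv huv =>
      ((hf v i).1 hv).2 u ((hf u i).1 hu).1 huv
    refine ⟨f, hval, fun i => ?_⟩
    have := dissatisfaction_add_score (a := a) (i := i) h hval fun u => ?_
    · have := hd i; omega
    · constructor
      · rintro ⟨v, hv, hvu⟩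
        obtain ⟨m, ⟨hm, hmv⟩, hmin⟩ := h.exists_minimal {x | x ∈ a i ∧ ReflTransGen G.Adj x v}
          ⟨v, hv, .refl⟩
        exact ⟨m, (hf m i).2 ⟨hm, fun u hu hum => hmin u ⟨hu, hum.trans hmv⟩ hum⟩, hmv.trans hvu⟩
      · rintro ⟨v, hv, hvu⟩
        exact ⟨v, ((hf v i).1 hv).1, hvu⟩
  · rintro ⟨f, hf, hd⟩
    refine ⟨fun i => {v | f v = some i}, fun i j hij => Set.disjoint_left.2 fun v hi hj => ?_,
      fun i => ?_⟩
    · exact hij (Option.some_inj.1 ((hi : f v = some i).symm.trans hj))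
    · have := dissatisfaction_add_score (a := fun i => {v | f v = some i}) (i := i) h hf
        fun u => Iff.rfl
      have := hd i; omega

end Forest

/-! ### Sets of codes and their recursion over the forest -/

section Tables

open Relation

variable {n k : ℕ} {G : Digraph (Fin n)}

/-- The codes of the valid allocations of items of `S`. -/
def codes (k : ℕ) (G : Digraph (Fin n)) (S : Set (Fin n)) : Set ℕ :=
  {x | ∃ f : Fin n → Option (Fin k), IsValid G f ∧ (∀ v, f v ≠ none → v ∈ S) ∧ x = code G f}

theorem lt_of_mem_codes (h : IsOutForest G) {S : Set (Fin n)} {x : ℕ} (hx : x ∈ codes k G S) :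
    x < (n + 1) ^ k := by
  obtain ⟨f, hf, -, rfl⟩ := hx
  exact (code_digit_and_lt h hf).2

theorem codes_empty : codes k G ∅ = {0} := by
  ext x; constructor
  · rintro ⟨f, -, hs, rfl⟩
    have : ∀ v, f v = none := fun v => by_contra fun hv => hs v hv
    simp [code, this]
  · rintro rfl
    exact ⟨fun _ => none, by simp [IsValid], by simp, by simp [code]⟩

/-- Validity constrains comparable items only, so valid colourings of `A` and of `C` can be glued
freely, and a colouring of the union splits into its two restrictions. The summand `codes k G A`
contained in `sumSet` is harmless: leave the items of `C` unassigned. -/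
theorem codes_union {A C : Set (Fin n)}
    (hAC : ∀ a ∈ A, ∀ c ∈ C, ¬ ReflTransGen G.Adj a c ∧ ¬ ReflTransGen G.Adj c a) :
    codes k G (A ∪ C) = sumSet (codes k G A) (codes k G C) 0 := by
  classical
  have hdis : ∀ v, v ∈ A → v ∉ C := fun v ha hc => (hAC v ha v hc).1 .refl
  have split : ∀ f f₁ f₂ : Fin n → Option (Fin k),
      (∀ v, (f v = f₁ v ∧ f₂ v = none) ∨ (f v = f₂ v ∧ f₁ v = none)) →
      code G f = code G f₁ + code G f₂ := by
    intro f f₁ f₂ hf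
    simp only [code]
    rw [← Finset.sum_add_distrib]
    refine Finset.sum_congr rfl fun v _ => ?_
    rcases hf v with ⟨h1, h2⟩ | ⟨h1, h2⟩ <;> simp [h1, h2]
  ext x; constructor
  · rintro ⟨f, hf, hs, rfl⟩
    refine Or.inr ⟨code G fun v => if v ∈ A then f v else none,
      ⟨_, ?_, ?_, rfl⟩, Nat.zero_le _, code G fun v => if v ∈ C then f v else none,
      ⟨_, ?_, ?_, rfl⟩, split _ _ _ fun v => ?_⟩
    · intro u v i hu hv
      simp only [ite_eq_iff, reduceCtorEq, and_false, or_false] at hu hv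
      exact hf u v i hu.2 hv.2
    · intro v hv; by_contra h; simp [h] at hv
    · intro u v i hu hv
      simp only [ite_eq_iff, reduceCtorEq, and_false, or_false] at hu hv
      exact hf u v i hu.2 hv.2
    · intro v hv; by_contra h; simp [h] at hv
    · by_cases hA : v ∈ A
      · exact Or.inl (by simp [hA, hdis v hA])
      · refine Or.inr ⟨?_, by simp [hA]⟩
        by_cases hC : v ∈ C
        · simp [hC]
        · rw [if_neg hC]
          exact by_contra fun hv => (hs v hv).elim hA hC
  · rintro (⟨f, hf, hs, rfl⟩ | ⟨_, ⟨f₁, hf₁, hs₁, rfl⟩, -, _, ⟨f₂, hf₂, hs₂, rfl⟩, rfl⟩)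
    · exact ⟨f, hf, fun v hv => Or.inl (hs v hv), rfl⟩
    · have hcases : ∀ v, f₁ v = none ∨ f₂ v = none := fun v => by
        by_contra! hv
        exact hdis v (hs₁ v hv.1) (hs₂ v hv.2)
      let f : Fin n → Option (Fin k) := fun v => if v ∈ A then f₁ v else f₂ v
      have hfA : ∀ v, v ∈ A → f v = f₁ v := fun v h => if_pos h
      have hfC : ∀ v, v ∉ A → f v = f₂ v := fun v h => if_neg h
      refine ⟨f, ?_, ?_, (split _ _ _ fun v => ?_).symm⟩
      · intro u v i hu hv huv
        by_cases hA : u ∈ A <;> by_cases hA' : v ∈ A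
        · exact hf₁ u v i (hfA u hA ▸ hu) (hfA v hA' ▸ hv) huv
        · rw [hfC v hA'] at hv
          exact absurd huv (hAC u hA v (hs₂ v (by simp [hv]))).1
        · rw [hfC u hA] at hu
          exact absurd huv (hAC v hA' u (hs₂ u (by simp [hu]))).2
        · exact hf₂ u v i (hfC u hA ▸ hu) (hfC v hA' ▸ hv) huv
      · intro v hv
        by_cases hA : v ∈ A
        · exact Or.inl hA
        · rw [hfC v hA] at hv; exact Or.inr (hs₂ v hv)
      · by_cases hA : v ∈ A
        · exact Or.inl ⟨hfA v hA, by_contra fun hv => hdis v hA (hs₂ v hv)⟩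
        · exact Or.inr ⟨hfC v hA, by_contra fun hv => hA (hs₁ v hv)⟩

theorem code_update {f : Fin n → Option (Fin k)} {v : Fin n} (hv : f v = none) (i : Fin k) :
    code G (Function.update f v (some i)) =
      code G f + (subtree G v).card * (n + 1) ^ (i : ℕ) := by
  classical
  unfold code
  rw [← Finset.add_sum_erase _ _ (Finset.mem_univ v),
    ← Finset.add_sum_erase (a := v) (f := fun u => (f u).elim 0 _) _ (Finset.mem_univ v),
    Function.update_self, hv, add_comm]
  simp only [Option.elim_some, Option.elim_none, zero_add]
  congr 1
  refine Finset.sum_congr rfl fun u hu => ?_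
  rw [Function.update_of_ne (Finset.ne_of_mem_erase hu)]

/-- Either `v` stays unassigned, or it goes to an agent without items below it. Because subtree
sizes are positive, having no item is the same as having score zero, so the code alone decides which
agents may get `v`. -/
theorem codes_subtree (h : IsOutForest G) {S : Set (Fin n)} {v : Fin n}
    (hS : ∀ u, u ∈ S ↔ ReflTransGen G.Adj v u ∧ u ≠ v) :
    codes k G (subtree G v) = giveSet (n + 1) (subtree G v).card k (codes k G S) 0 := by
  have hvS : v ∉ S := fun hv => ((hS v).1 hv).2 rfl
  have hSv : ∀ u ∈ S, u ∈ (subtree G v : Set (Fin n)) := fun u hu => by simpa using ((hS u).1 hu).1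
  have hvS' : ∀ u ∈ (subtree G v : Set (Fin n)), u ≠ v → u ∈ S :=
    fun u hu huv => (hS u).2 ⟨by simpa using hu, huv⟩
  ext x; constructor
  · rintro ⟨f, hf, hs, rfl⟩
    cases hv : f v with
    | none =>
      refine Or.inl ⟨f, hf, fun u hu => hvS' u (hs u hu) ?_, rfl⟩
      rintro rfl; exact hu hv
    | some i =>
      have hval : IsValid G (Function.update f v none) := by
        intro a b j ha hb
        have hav : a ≠ v := by rintro rfl; simp at ha
        have hbv : b ≠ v := by rintro rfl; simp at hb
        rw [Function.update_of_ne hav] at ha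
        rw [Function.update_of_ne hbv] at hb
        exact hf a b j ha hb
      refine Or.inr ⟨code G (Function.update f v none), ⟨_, hval, fun u hu => ?_, rfl⟩,
        Nat.zero_le _, i, i.2, ?_, ?_⟩
      · have huv : u ≠ v := by rintro rfl; simp at hu
        rw [Function.update_of_ne huv] at hu
        exact hvS' u (hs u hu) huv
      -- Everything else coloured by `f` lies below `v`, so by validity agent `i` owns nothing once
      -- `v` is removed.
      · rw [(code_digit_and_lt h hval).1, score]
        refine Finset.sum_eq_zero fun u _ => if_neg fun hu => ?_
        have huv : u ≠ v := by rintro rfl; simp at hu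
        rw [Function.update_of_ne huv] at hu
        have hvu : ReflTransGen G.Adj v u := by simpa using hs u (by simp [hu])
        exact huv (hf v u i hv hu hvu).symm
      · rw [← code_update (by simp) i, Function.update_idem]
        congr 1
        rw [← hv, Function.update_eq_self]
  · rintro (⟨f, hf, hs, rfl⟩ | ⟨_, ⟨f, hf, hs, rfl⟩, -, j, hj, h0, rfl⟩)
    · exact ⟨f, hf, fun u hu => hSv u (hs u hu), rfl⟩
    · have hv : f v = none := by_contra fun hv => hvS (hs v hv)
      have hscore := (code_digit_and_lt h hf).1 ⟨j, hj⟩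
      rw [h0, eq_comm, score, Finset.sum_eq_zero_iff] at hscore
      have hnot : ∀ u, f u ≠ some ⟨j, hj⟩ := fun u hu => by
        have := hscore u (Finset.mem_univ u)
        rw [if_pos hu] at this
        exact (card_subtree_pos u).ne' this
      refine ⟨Function.update f v (some ⟨j, hj⟩), ?_, ?_, (code_update hv ⟨j, hj⟩).symm⟩
      · intro a b i ha hb hab
        by_cases hav : a = v <;> by_cases hbv : b = v
        · rw [hav, hbv]
        · subst hav
          rw [Function.update_self] at ha
          rw [Function.update_of_ne hbv, ← ha] at hb
          exact absurd hb (hnot b)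
        · subst hbv
          rw [Function.update_self] at hb
          rw [Function.update_of_ne hav, ← hb] at ha
          exact absurd ha (hnot a)
        · rw [Function.update_of_ne hav] at ha
          rw [Function.update_of_ne hbv] at hb
          exact hf a b i ha hb hab
      · intro u hu
        by_cases huv : u = v
        · subst huv; simp [ReflTransGen.refl]
        · rw [Function.update_of_ne huv] at hu
          exact hSv u (hs u hu)

/-- `pa` maps each item, shifted by one, to its parent, shifted by one, and the roots to zero. -/
def IsParentMap (G : Digraph (Fin n)) (pa : ℕ → ℕ) : Prop :=
  ∀ v : Fin n, (∃ u : Fin n, G.Adj u v ∧ pa (v + 1) = u + 1) ∨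
    (pa (v + 1) = 0 ∧ ∀ u, ¬ G.Adj u v)

theorem IsParentMap.adj_iff (h : IsOutForest G) {pa : ℕ → ℕ} (hpa : IsParentMap G pa)
    {u v : Fin n} : pa (v + 1) = u + 1 ↔ G.Adj u v := by
  rcases hpa v with ⟨w, hw, e⟩ | ⟨e, hn⟩
  · rw [e]
    constructor
    · intro e'; rwa [show u = w from Fin.ext (by omega)]
    · intro huv; rw [h.adj_unique hw huv]
  · exact ⟨fun e' => by omega, fun huv => absurd huv (hn u)⟩

theorem IsParentMap.lt {pa : ℕ → ℕ} (hpa : IsParentMap G pa) (v : Fin n) :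
    pa (v + 1) < n + 1 := by
  rcases hpa v with ⟨w, -, e⟩ | ⟨e, -⟩ <;> omega

/-- The items available in table `w` when the items of `D` have been processed. -/
def available (G : Digraph (Fin n)) (pa : ℕ → ℕ) (D : Set (Fin n)) (w : ℕ) : Set (Fin n) :=
  {u | ∃ c ∈ D, (w = c + 1 ∨ w = pa (c + 1)) ∧ ReflTransGen G.Adj c u}

/-- The tables when the items of `D` have been processed. -/
def tables (k : ℕ) (G : Digraph (Fin n)) (pa : ℕ → ℕ) (D : Set (Fin n)) (w : ℕ) : Set ℕ :=
  {x | w < n + 1 ∧ x ∈ codes k G (available G pa D w)}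

theorem tables_of_lt {pa : ℕ → ℕ} {D : Set (Fin n)} {w : ℕ} (hw : w < n + 1) :
    tables k G pa D w = codes k G (available G pa D w) := by
  ext; simp [tables, hw]

section Step

variable {pa : ℕ → ℕ} {D : Set (Fin n)} {v : Fin n}

/-- When the children of `v` are done but `v` is not, the table of `v` has collected exactly the
children's subtrees, that is, the proper descendants of `v`. -/
theorem available_succ (h : IsOutForest G) (hpa : IsParentMap G pa)
    (hv : v ∉ D) (hchild : ∀ c, G.Adj v c → c ∈ D) (u : Fin n) :
    u ∈ available G pa D (v + 1) ↔ ReflTransGen G.Adj v u ∧ u ≠ v := by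
  constructor
  · rintro ⟨c, hc, hcv | hcv, hcu⟩
    · exact absurd hc (by rwa [show c = v from Fin.ext (by omega)])
    · have hvc := (hpa.adj_iff h).1 hcv.symm
      refine ⟨hcu.head hvc, ?_⟩
      rintro rfl
      exact h.isAcyclic _ (TransGen.head' hvc hcu)
  · rintro ⟨hvu, hne⟩
    rcases ReflTransGen.cases_head hvu with rfl | ⟨c, hvc, hcu⟩
    · exact absurd rfl hne
    · exact ⟨c, hchild c hvc, Or.inr ((hpa.adj_iff h).2 hvc).symm, hcu⟩

/-- Siblings, or two roots, are incomparable: a path from `c` to `v` would pass through the parent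
of `v`, which is also the parent of `c`, and close a cycle. -/
theorem not_reflTransGen_of_parent_eq (h : IsOutForest G) (hpa : IsParentMap G pa) {c : Fin n}
    (hcv : c ≠ v) (hp : pa (v + 1) = pa (c + 1)) : ¬ ReflTransGen G.Adj c v := by
  intro hr
  rcases ReflTransGen.cases_tail hr with e | ⟨p, hcp, hpv⟩
  · exact hcv e.symm
  · have hpc : G.Adj p c := (hpa.adj_iff h).1 (hp ▸ (hpa.adj_iff h).2 hpv)
    exact h.isAcyclic _ (TransGen.head' hpc hcp)

/-- The parts are the table of `v` after giving out `v`, the parent's table after adding the former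
to it, and the fact that no other table changes. -/
theorem tables_insert (h : IsOutForest G) (hpa : IsParentMap G pa)
    (hv : v ∉ D) (hchild : ∀ c, G.Adj v c → c ∈ D) (hparent : ∀ p, G.Adj p v → p ∉ D) :
    giveSet (n + 1) (subtree G v).card k (tables k G pa D (v + 1)) 0 = codes k G (subtree G v) ∧
    sumSet (tables k G pa D (pa (v + 1))) (codes k G (subtree G v)) 0 =
      tables k G pa (insert v D) (pa (v + 1)) ∧
    tables k G pa (insert v D) = Function.update
      (Function.update (tables k G pa D) (v + 1) (codes k G (subtree G v))) (pa (v + 1))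
      (tables k G pa (insert v D) (pa (v + 1))) := by
  have hgive : giveSet (n + 1) (subtree G v).card k (tables k G pa D (v + 1)) 0 =
      codes k G (subtree G v) := by
    rw [tables_of_lt (by omega), codes_subtree h (available_succ h hpa hv hchild)]
  have hneq : pa (v + 1) ≠ v + 1 := fun e =>
    h.isAcyclic v (.single ((hpa.adj_iff h).1 e))
  refine ⟨hgive, ?_, ?_⟩
  · rw [tables_of_lt (hpa.lt v), tables_of_lt (hpa.lt v), ← codes_union]
    · congr 1
      ext u; constructor
      · rintro (⟨c, hc, hw, hcu⟩ | hu)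
        · exact ⟨c, Or.inr hc, hw, hcu⟩
        · exact ⟨v, Or.inl rfl, Or.inr rfl, by simpa using hu⟩
      · rintro ⟨c, rfl | hc, hw, hcu⟩
        · exact Or.inr (by simpa using hcu)
        · exact Or.inl ⟨c, hc, hw, hcu⟩
    · rintro u ⟨c, hc, hw, hcu⟩ u' hu'
      replace hu' : ReflTransGen G.Adj v u' := by simpa using hu'
      have hcv : c ≠ v := fun e => hv (e ▸ hc)
      -- The parent is not yet processed, so its table only consists of subtrees of siblings of `v`.
      have hp : pa (v + 1) = pa (c + 1) := by
        rcases hw with hw | hw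
        · exact absurd hc (hparent c ((hpa.adj_iff h).1 hw))
        · exact hw
      have h1 := not_reflTransGen_of_parent_eq h hpa hcv hp
      have h2 := not_reflTransGen_of_parent_eq h hpa hcv.symm hp.symm
      constructor
      · intro huu
        rcases h.comparable (hcu.trans huu) hu' with e | e
        exacts [h1 e, h2 e]
      · intro huu
        rcases h.comparable hcu (hu'.trans huu) with e | e
        exacts [h1 e, h2 e]
  · funext w
    by_cases hwp : w = pa (v + 1)
    · rw [hwp, Function.update_self]
    rw [Function.update_of_ne hwp]
    by_cases hwv : w = v + 1
    · rw [hwv, Function.update_self, tables_of_lt (by omega)]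
      congr 1
      ext u; constructor
      · rintro ⟨c, rfl | hc, hw, hcu⟩
        · simpa using hcu
        · simpa using ((available_succ h hpa hv hchild u).1 ⟨c, hc, hw, hcu⟩).1
      · intro hu; exact ⟨v, Or.inl rfl, Or.inl rfl, by simpa using hu⟩
    · rw [Function.update_of_ne hwv]
      ext x
      have : available G pa (insert v D) w = available G pa D w := by
        ext u; constructor
        · rintro ⟨c, rfl | hc, hw, hcu⟩
          · exact absurd hw (by tauto)
          · exact ⟨c, hc, hw, hcu⟩
        · rintro ⟨c, hc, hw⟩; exact ⟨c, Or.inr hc, hw⟩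
      simp [tables, this]

end Step

theorem available_univ (h : IsOutForest G) {pa : ℕ → ℕ} (hpa : IsParentMap G pa) :
    available G pa Set.univ 0 = Set.univ := by
  refine Set.eq_univ_of_forall fun u => ?_
  obtain ⟨m, hm, hmin⟩ := h.exists_minimal {x | ReflTransGen G.Adj x u} ⟨u, .refl⟩
  refine ⟨m, trivial, Or.inr ?_, hm⟩
  rcases hpa m with ⟨p, hp, -⟩ | ⟨e, -⟩
  · have := hmin p (hm.head hp) (.single hp)
    subst this
    exact absurd (.single hp) (h.isAcyclic _)
  · exact e.symm

theorem minMaxDissatisfaction_iff_tables (h : IsOutForest G) {pa : ℕ → ℕ}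
    (hpa : IsParentMap G pa) (d : ℤ) :
    MinMaxDissatisfaction k G d ↔ ∃ x ∈ tables k G pa Set.univ 0,
      ∀ i < k, (n : ℤ) ≤ (x / (n + 1) ^ i % (n + 1) : ℕ) + d := by
  rw [minMaxDissatisfaction_iff h, tables_of_lt (by omega), available_univ h hpa]
  constructor
  · rintro ⟨f, hf, hd⟩
    refine ⟨_, ⟨f, hf, fun _ _ => trivial, rfl⟩, fun i hi => ?_⟩
    rw [(code_digit_and_lt h hf).1 ⟨i, hi⟩]; exact hd _
  · rintro ⟨_, ⟨f, hf, -, rfl⟩, hd⟩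
    refine ⟨f, hf, fun i => ?_⟩
    rw [← (code_digit_and_lt h hf).1 i]; exact hd _ i.2

/-- The empty allocation has code zero. The clause `w < n + 1` keeps `memOf` zero beyond the last
table, like the actual memory. -/
theorem tables_empty {pa : ℕ → ℕ} : tables k G pa ∅ = fun w => {x | w < n + 1 ∧ x = 0} := by
  funext w
  have : available G pa ∅ w = ∅ := by simp [available]
  simp [tables, this, codes_empty]

end Tables

/-! ### Processing all items -/

/-- Process the item in register `21`. -/
def processProg (k : ℕ) : Prog :=
  .seq (mulProg 21 rL) (.seq (.add 20 rZ 0) (.seq (.add 5 rX 21) (.seq (.load 18 5)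
    (.seq (mulProg 18 rL) (.seq (.add 19 rZ 0) (.seq (.add 10 rL rZero) (.seq (giveProg k)
      (.seq (.add 12 rL rZero) sumProg))))))))

/-- A bound for the time in which an item is processed. -/
def processTime (k B N : ℕ) : ℕ :=
  6 * B + 13 + N * (k * (4 * N + 3 * B + 16) + 9) + N * (7 * N + 7)

theorem runs_processProg {k n W X : ℕ} {d : ℤ} {G : Digraph (Fin n)} {inp : ℕ → ℤ}
    {pa sz : ℕ → ℕ} {D : Set (Fin n)} {v : Fin n} {s : State}
    (henv : Env W (n + 1) ((n + 1) ^ k) X d s) (hkW : k ≤ W)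
    (h : IsOutForest G) (hpa : IsParentMap G pa)
    (hv : v ∉ D) (hchild : ∀ c, G.Adj v c → c ∈ D) (hparent : ∀ p, G.Adj p v → p ∉ D)
    (h21 : s.reg 21 = (v + 1 : ℕ)) (h23 : s.reg 23 = (subtree G v).card)
    (hmem : s.mem = memOf (n + 1) ((n + 1) ^ k) X inp pa sz (tables k G pa D)) :
    Runs W (processProg k) s (processTime k (n + 1) ((n + 1) ^ k)) (fun s' => Frame 21 s s' ∧
      s'.mem = memOf (n + 1) ((n + 1) ^ k) X inp pa sz (tables k G pa (insert v D))) := by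
  obtain ⟨hgive, hsum, htab⟩ := tables_insert (k := k) h hpa hv hchild hparent
  have hword := henv.word
  set N := (n + 1) ^ k with hN
  have hBN : N ≤ (n + 1) * N := Nat.le_mul_of_pos_left N henv.base_pos
  have hle : ∀ w, w < n + 1 → w * N + N ≤ (n + 1) * N := fun w hw => by
    calc w * N + N = (w + 1) * N := by ring
      _ ≤ (n + 1) * N := Nat.mul_le_mul_right N hw
  have hw1 : (v : ℕ) + 1 < n + 1 := by omega
  have hp := hpa.lt v
  have hwN := hle _ hw1
  have hpN := hle _ hp
  have hneq : pa (v + 1) ≠ v + 1 := fun e =>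
    h.isAcyclic v (.single ((hpa.adj_iff h).1 e))
  have htlt : ∀ w, ∀ a ∈ tables k G pa D w, a < N := fun w a ha => lt_of_mem_codes h ha.2
  unfold processProg processTime
  refine Runs.seq (runs_mulProg (by norm_num) (by norm_num) henv.one henv.zero h21 henv.len
    (by omega) (by omega)) (T₂ := N * (k * (4 * N + 3 * (n + 1) + 16) + 9) + N * (7 * N + 7) +
      3 * n + 14) (by omega) ?_
  rintro s₁ ⟨hF₁, h0₁, hm₁⟩
  have henv₁ := henv.frame hF₁ (by norm_num)
  have h21₁ : s₁.reg 21 = (v + 1 : ℕ) := (hF₁ 21 (by norm_num)).trans h21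
  have e₁ : s₁.reg rZ + s₁.reg 0 = (X + 2 * (n + 1) + (v + 1) * N : ℕ) := by
    rw [henv₁.table, h0₁]; push_cast; ring
  have e₂ : s₁.reg rX + s₁.reg 21 = (X + (v + 1) : ℕ) := by
    rw [henv₁.par, h21₁]; push_cast; ring
  refine Runs.seq_add (T := N * (k * (4 * N + 3 * (n + 1) + 16) + 9) + N * (7 * N + 7) +
      3 * n + 13) ?_ (Runs.seq_add ?_ (Runs.seq_load (a := X + (v + 1)) ?_ ?_))
  · rw [e₁, Nat.abs_cast]; exact_mod_cast (by omega)
  · simp only [State.reg_setReg]; norm_num only [if_false]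
    rw [e₂, Nat.abs_cast]; exact_mod_cast (by omega)
  · simp only [State.reg_setReg]; norm_num only [if_true, if_false]
    rw [e₂]
  set s₂ := State.setReg _ 18 _ with hs₂
  have hF₂ : Frame 21 s₁ s₂ := by
    rw [hs₂]
    exact (((Frame.refl _ _).setReg (by norm_num)).setReg (by norm_num)).setReg (by norm_num)
  have henv₂ := henv₁.frame hF₂ (by norm_num)
  have h18₂ : s₂.reg 18 = (pa (v + 1) : ℕ) := by
    simp [hs₂, State.reg_setReg, hm₁, hmem, memOf_par hw1]
  have h20₂ : s₂.reg 20 = (X + 2 * (n + 1) + (v + 1) * N : ℕ) := by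
    simp [hs₂, State.reg_setReg, e₁]
  have hm₂ : s₂.mem = s.mem := by simp [hs₂, hm₁]
  refine Runs.seq (runs_mulProg (by norm_num) (by norm_num) henv₂.one henv₂.zero h18₂ henv₂.len
    (by omega) (by omega)) (T₂ := N * (k * (4 * N + 3 * (n + 1) + 16) + 9) + N * (7 * N + 7) + 5)
    (by omega) ?_
  rintro s₃ ⟨hF₃, h0₃, hm₃⟩
  have henv₃ := henv₂.frame hF₃ (by norm_num)
  have h20₃ := (hF₃ 20 (by norm_num)).trans h20₂
  have e₃ : s₃.reg rZ + s₃.reg 0 = (X + 2 * (n + 1) + pa (v + 1) * N : ℕ) := by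
    rw [henv₃.table, h0₃]; push_cast; ring
  refine Runs.seq_add (T := N * (k * (4 * N + 3 * (n + 1) + 16) + 9) + N * (7 * N + 7) + 4) ?_ (Runs.seq_add ?_ ?_)
  · rw [e₃, Nat.abs_cast]; exact_mod_cast (by omega)
  · simp only [State.reg_setReg]; norm_num only [if_false]
    rw [henv₃.len, henv₃.zero, add_zero, Nat.abs_cast]; exact_mod_cast (by omega)
  set s₄ := State.setReg _ 10 _ with hs₄
  have hF₄ : Frame 20 s₃ s₄ := by
    rw [hs₄]
    exact ((Frame.refl _ _).setReg (by norm_num)).setReg (by norm_num)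
  have henv₄ := henv₃.frame hF₄ (by norm_num)
  have h23₄ : s₄.reg 23 = (subtree G v).card := by
    rw [hF₄ 23 (by norm_num), hF₃ 23 (by norm_num), hF₂ 23 (by norm_num), hF₁ 23 (by norm_num), h23]
  have h20₄ := (hF₄ 20 (by norm_num)).trans h20₃
  have h10₄ : s₄.reg 10 = N := by simp [hs₄, State.reg_setReg, henv₃.len, henv₃.zero]
  have h19₄ : s₄.reg 19 = (X + 2 * (n + 1) + pa (v + 1) * N : ℕ) := by
    simp [hs₄, State.reg_setReg, e₃]
  have hm₄ : s₄.mem = memOf (n + 1) N X inp pa sz (tables k G pa D) := by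
    rw [← hmem, ← hm₂, ← hm₃]; simp [hs₄]
  refine Runs.seq (runs_giveProg henv₄ hw1 (Nat.lt_succ_of_le (card_subtree_le v)) hkW le_rfl
    (htlt _) (fun a ha i hi h0 => ?_) h10₄ h20₄ h23₄ hm₄) (T₂ := N * (7 * N + 7) + 2)
    (by omega) ?_
  -- Each number to be marked is the code of a valid allocation, hence below `N`.
  · refine lt_of_mem_codes h (S := subtree G v) ?_
    rw [← hgive]
    exact Or.inr ⟨a, ha, Nat.zero_le _, i, hi, h0, rfl⟩
  rintro s₅ ⟨hF₅, hm₅⟩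
  have henv₅ := henv₄.frame hF₅ (by norm_num)
  have h20₅ := (hF₅ 20 (by norm_num)).trans h20₄
  have h19₅ := (hF₅ 19 (by norm_num)).trans h19₄
  rw [hgive] at hm₅
  refine Runs.seq_add ?_ ?_
  · rw [henv₅.len, henv₅.zero, add_zero, Nat.abs_cast]; exact_mod_cast (by omega)
  have hF₆ : Frame 13 s₅ (s₅.setReg 12 (s₅.reg rL + s₅.reg rZero)) :=
    (Frame.refl _ _).setReg (by norm_num)
  refine Runs.mono (runs_sumProg (henv₅.frame hF₆ (by norm_num)) hw1 hp hneq ?_ ?_ ?_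
    (by simp [State.reg_setReg, henv₅.len, henv₅.zero])
    ((hF₆ 19 (by norm_num)).trans h19₅) ((hF₆ 20 (by norm_num)).trans h20₅) hm₅) le_rfl ?_
  · rw [Function.update_self]
    exact fun a ha => lt_of_mem_codes h ha
  · rw [Function.update_of_ne hneq]; exact htlt _
  · rw [Function.update_self, Function.update_of_ne hneq]
    intro c hc a ha
    have : c + a ∈ tables k G pa (insert v D) (pa (v + 1)) := by
      rw [← hsum]; exact Or.inr ⟨c, hc, Nat.zero_le _, a, ha, rfl⟩
    exact lt_of_mem_codes h this.2
  · rintro s₇ ⟨hF₇, hm₇⟩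
    refine ⟨((((((hF₁.mono (by norm_num)).trans hF₂).trans (hF₃.mono (by norm_num))).trans
      (hF₄.mono (by norm_num))).trans (hF₅.mono (by norm_num))).trans
      (hF₆.mono (by norm_num))).trans (hF₇.mono (by norm_num)), ?_⟩
    rw [hm₇, Function.update_self, Function.update_of_ne hneq, hsum, ← htab]

/-- Process the item in register `22` if its subtree has the size in register `23`. -/
def selectProg (k : ℕ) : Prog :=
  .seq (.add 21 22 rOne) (.seq (.add 5 rY 21) (.seq (.load 5 5) (.seq (.sub 6 23 5)
    (.ifPos 6 .nop (.seq (.sub 6 5 23) (.ifPos 6 .nop (processProg k)))))))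

/-- Process all items, in the order of their subtree sizes. -/
def mainProg (k : ℕ) : Prog :=
  .seq (.add 24 rN rZero) (forDown 24 (.seq (.sub 23 rN 24) (.seq (.add 22 rN rZero)
    (forDown 22 (selectProg k)))))

/-- Items are processed by increasing size and, within a size, by decreasing index. Children of `v`
are strictly smaller and its parent strictly larger, so the requirements on the processed set hold
whatever the order within a size. -/
theorem runs_selectProg {k n W X m : ℕ} {d : ℤ} {G : Digraph (Fin n)} {inp : ℕ → ℤ}
    {pa sz : ℕ → ℕ} {v : Fin n} {s : State}
    (henv : Env W (n + 1) ((n + 1) ^ k) X d s) (hkW : k ≤ W) (hmn : m ≤ n)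
    (h : IsOutForest G) (hpa : IsParentMap G pa)
    (hsz : ∀ u : Fin n, sz (u + 1) = (subtree G u).card)
    (h22 : s.reg 22 = (v : ℕ)) (h23 : s.reg 23 = m)
    (hmem : s.mem = memOf (n + 1) ((n + 1) ^ k) X inp pa sz (tables k G pa
      {u | (subtree G u).card < m ∨ (subtree G u).card = m ∧ (v : ℕ) + 1 ≤ u})) :
    Runs W (selectProg k) s (processTime k (n + 1) ((n + 1) ^ k) + 8) (fun s' => Frame 22 s s' ∧
      s'.mem = memOf (n + 1) ((n + 1) ^ k) X inp pa sz (tables k G pa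
      {u | (subtree G u).card < m ∨ (subtree G u).card = m ∧ (v : ℕ) ≤ u})) := by
  have hword := henv.word
  set N := (n + 1) ^ k with hN
  have hw1 : (v : ℕ) + 1 < n + 1 := by omega
  have hle := card_subtree_le (G := G) v
  have e₁ : s.reg 22 + s.reg rOne = (v + 1 : ℕ) := by rw [h22, henv.one]; push_cast; rfl
  have e₂ : s.reg rY + (v + 1 : ℕ) = (X + (n + 1) + (v + 1) : ℕ) := by
    rw [henv.sz]; push_cast; ring
  have hskip : (subtree G v).card ≠ m →
      {u | (subtree G u).card < m ∨ (subtree G u).card = m ∧ (v : ℕ) + 1 ≤ u} =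
      {u | (subtree G u).card < m ∨ (subtree G u).card = m ∧ (v : ℕ) ≤ u} := by
    intro hne
    ext u
    refine or_congr Iff.rfl (and_congr_right fun hu => ?_)
    have : v ≠ u := by rintro rfl; exact hne hu
    have : (v : ℕ) ≠ u := fun e => this (Fin.ext e)
    omega
  unfold selectProg
  refine Runs.seq_add ?_ (Runs.seq_add ?_ (Runs.seq_load (a := X + (n + 1) + (v + 1)) ?_
    (Runs.seq_sub ?_ ?_)))
  · rw [e₁, Nat.abs_cast]; exact_mod_cast (by omega)
  · simp only [State.reg_setReg]; norm_num only [if_true, if_false]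
    rw [e₁, e₂, Nat.abs_cast]; exact_mod_cast (by omega)
  · simp only [State.reg_setReg]; norm_num only [if_true, if_false]
    rw [e₁, e₂]
  · simp only [State.reg_setReg, State.mem_setReg]; norm_num only [if_true, if_false]
    rw [hmem, memOf_sz hw1, hsz, h23, abs_le]; omega
  set s₁ := State.setReg _ 6 _ with hs₁
  have hF₁ : Frame 22 s s₁ := by
    rw [hs₁]
    exact ((((Frame.refl _ _).setReg (by norm_num)).setReg (by norm_num)).setReg
      (by norm_num)).setReg (by norm_num)
  have h5₁ : s₁.reg 5 = (subtree G v).card := by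
    simp [hs₁, State.reg_setReg, hmem, memOf_sz hw1, hsz]
  have h6₁ : s₁.reg 6 = m - (subtree G v).card := by
    simp [hs₁, State.reg_setReg, hmem, memOf_sz hw1, hsz, h23]
  have h21₁ : s₁.reg 21 = (v + 1 : ℕ) := by
    simp [hs₁, State.reg_setReg, e₁]
  have h23₁ : s₁.reg 23 = m := (hF₁ 23 (by norm_num)).trans h23
  have hm₁ : s₁.mem = s.mem := by simp [hs₁]
  refine Runs.ifPos (T := processTime k (n + 1) N + 3) (fun hpos => ?_) fun hneg =>
    Runs.seq_sub ?_ ?_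
  · refine Runs.nop ⟨hF₁, ?_⟩
    rw [hm₁, hmem, hskip (by omega)]
  · rw [h5₁, h23₁, abs_le]; omega
  have hF₂ : Frame 22 s (s₁.setReg 6 (s₁.reg 5 - s₁.reg 23)) := hF₁.setReg (by norm_num)
  refine Runs.ifPos (fun hpos => ?_) fun hneg' => ?_
  · refine Runs.nop ⟨hF₂, ?_⟩
    simp only [State.reg_setReg, if_true] at hpos
    rw [State.mem_setReg, hm₁, hmem, hskip (by omega)]
  · simp only [State.reg_setReg, if_true] at hneg'
    have hcard : (subtree G v).card = m := by omega
    refine Runs.mono (runs_processProg (henv.frame hF₂ (by norm_num)) hkW h hpa (v := v)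
      (D := {u | (subtree G u).card < m ∨ (subtree G u).card = m ∧ (v : ℕ) + 1 ≤ u})
      ?_ ?_ ?_ (by simpa [State.reg_setReg] using h21₁)
      (by rw [hcard]; simpa [State.reg_setReg] using h23₁) (by rw [State.mem_setReg, hm₁, hmem]))
      (Nat.le_succ _) ?_
    · simp [hcard]
    · intro c hc
      exact Or.inl (hcard ▸ h.card_subtree_lt hc)
    · intro p hp
      have := h.card_subtree_lt hp
      simp only [Set.mem_ofPred_eq]; omega
    · rintro s₃ ⟨hF₃, hm₃⟩
      refine ⟨hF₂.trans (hF₃.mono (by norm_num)), ?_⟩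
      rw [hm₃]
      congr 2
      ext u
      simp only [Set.mem_insert_iff, Set.mem_ofPred_eq, Fin.ext_iff]
      constructor
      · rintro (e | hu)
        · obtain rfl : u = v := Fin.ext e
          exact Or.inr ⟨hcard, le_rfl⟩
        · omega
      · omega

theorem runs_mainProg {k n W X : ℕ} {d : ℤ} {G : Digraph (Fin n)} {inp : ℕ → ℤ}
    {pa sz : ℕ → ℕ} {s : State}
    (henv : Env W (n + 1) ((n + 1) ^ k) X d s) (hkW : k ≤ W)
    (h : IsOutForest G) (hpa : IsParentMap G pa)
    (hsz : ∀ u : Fin n, sz (u + 1) = (subtree G u).card)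
    (hmem : s.mem = memOf (n + 1) ((n + 1) ^ k) X inp pa sz (tables k G pa ∅)) :
    Runs W (mainProg k) s (n * (n * (processTime k (n + 1) ((n + 1) ^ k) + 10) + 5) + 2)
      (fun s' => Frame 25 s s' ∧
        s'.mem = memOf (n + 1) ((n + 1) ^ k) X inp pa sz (tables k G pa Set.univ)) := by
  have hword := henv.word
  set N := (n + 1) ^ k with hN
  have hn : s.reg rN = n := by rw [henv.n]; push_cast; ring
  unfold mainProg
  refine Runs.seq_add ?_ ?_
  · rw [hn, henv.zero, add_zero, Nat.abs_cast]; exact_mod_cast (by omega)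
  set s₁ := State.setReg _ 24 _ with hs₁
  have hF₁ : Frame 25 s s₁ := (Frame.refl _ _).setReg (by norm_num)
  have henv₁ := henv.frame hF₁ (by norm_num)
  -- While the counter `j` runs down, the treated size `n - j` runs up.
  refine Runs.mono (Runs.forDown (m := n) (C := n * (processTime k (n + 1) N + 10) + 3)
    (fun j s' => s'.mem = memOf (n + 1) N X inp pa sz (tables k G pa
      {u | (subtree G u).card ≤ n - j})) (by norm_num) henv₁.one
    (by simp [hs₁, State.reg_setReg, hn, henv.zero]) (by omega) ?_ (fun _ _ _ h => h) ?_)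
    le_rfl ?_
  · rw [hs₁, State.mem_setReg, hmem]
    congr 2
    ext u
    have := card_subtree_pos (G := G) u
    exact ⟨fun hu => hu.elim, fun hu => by simp only [Set.mem_ofPred_eq] at hu; omega⟩
  · rintro j hj s₂ hF₂ h24₂ hm₂
    have henv₂ := henv₁.frame hF₂ (by norm_num)
    have hn₂ : s₂.reg rN = n := by rw [henv₂.n]; push_cast; ring
    refine Runs.seq_sub ?_ (Runs.seq_add ?_ ?_)
    · rw [hn₂, h24₂, abs_le]; omega
    · simp only [State.reg_setReg]; norm_num only [if_false]
      rw [hn₂, henv₂.zero, add_zero, Nat.abs_cast]; exact_mod_cast (by omega)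
    set s₃ := State.setReg _ 22 _ with hs₃
    have hF₃ : Frame 24 s₂ s₃ := by
      rw [hs₃]; exact ((Frame.refl _ _).setReg (by norm_num)).setReg (by norm_num)
    have henv₃ := henv₂.frame hF₃ (by norm_num)
    have h23₃ : s₃.reg 23 = (n - j : ℕ) := by
      simp [hs₃, State.reg_setReg, hn₂, h24₂]; omega
    refine Runs.mono (Runs.forDown (m := n) (C := processTime k (n + 1) N + 8)
      (fun i s' => s'.mem = memOf (n + 1) N X inp pa sz (tables k G pa
      {u | (subtree G u).card < n - j ∨ (subtree G u).card = n - j ∧ i ≤ u})) (by norm_num)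
      henv₃.one (by simp [hs₃, State.reg_setReg, hn₂, henv₂.zero]) (by omega) ?_
      (fun _ _ _ h => h) ?_) le_rfl ?_
    · rw [hs₃, State.mem_setReg, State.mem_setReg, hm₂]
      congr 2
      ext u
      simp only [Set.mem_ofPred_eq]; omega
    · rintro i hi s₄ hF₄ h22₄ hm₄
      exact runs_selectProg (v := ⟨i, hi⟩) (henv₃.frame hF₄ (by norm_num)) hkW (by omega) h hpa hsz
        h22₄ ((hF₄ 23 (by norm_num)).trans h23₃) hm₄
    · rintro s₄ ⟨hF₄, hm₄⟩
      refine ⟨hF₃.trans (hF₄.mono (by norm_num)), ?_⟩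
      rw [hm₄]
      congr 2
      ext u
      simp only [Set.mem_ofPred_eq]; omega
  · rintro s₂ ⟨hF₂, hm₂⟩
    refine ⟨hF₁.trans hF₂, ?_⟩
    rw [hm₂]
    congr 2
    ext u
    simpa using card_subtree_le u

/-! ### Reading off the answer -/

/-- Clear register `7` if the last digit of the number in register `2` is too small, and remove
the digit. -/
def checkDigitProg : Prog :=
  .seq divProg (.seq (.sub 1 rN rD) (.seq (.sub 1 1 2) (.seq (.ifPos 1 (.const 7 0) .nop)
    (.add 2 0 rZero))))

/-- Look for a number in table `0` all of whose digits are large enough. -/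
def answerProg (k : ℕ) : Prog :=
  .seq (.const 11 0) (.seq (.add 12 rL rZero) (.seq
    (forDown 12 (.seq (.add 9 rZ 12) (.seq (.load 5 9) (.ifPos 5
      (.seq (.add 2 12 rZero) (.seq (.const 7 1) (.seq (.const 8 k)
        (.seq (forDown 8 checkDigitProg) (.ifPos 7 (.const 11 1) .nop))))) .nop))))
    (.add 0 11 rZero)))

/-- A digit fails iff `n - d` minus the digit is positive; register `7` records whether all digits
so far have passed. Here the word size must accommodate `|d|`. -/
theorem runs_checkDigitProg {W n N X a i : ℕ} {d : ℤ} {s : State}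
    (henv : Env W (n + 1) N X d s) (ha : a < N) (h2 : s.reg 2 = (a / (n + 1) ^ i : ℕ))
    (h7 : (s.reg 7 = 1 ∧ ∀ j < i, (n : ℤ) ≤ (a / (n + 1) ^ j % (n + 1) : ℕ) + d) ∨
      (s.reg 7 = 0 ∧ ¬ ∀ j < i, (n : ℤ) ≤ (a / (n + 1) ^ j % (n + 1) : ℕ) + d)) :
    Runs W checkDigitProg s (4 * N + 9) (fun s' => Frame 8 s s' ∧ s'.mem = s.mem ∧
      s'.reg 2 = (a / (n + 1) ^ (i + 1) : ℕ) ∧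
      ((s'.reg 7 = 1 ∧ ∀ j < i + 1, (n : ℤ) ≤ (a / (n + 1) ^ j % (n + 1) : ℕ) + d) ∨
      (s'.reg 7 = 0 ∧ ¬ ∀ j < i + 1, (n : ℤ) ≤ (a / (n + 1) ^ j % (n + 1) : ℕ) + d))) := by
  have hword := henv.word
  have hBN : N ≤ (n + 1) * N := Nat.le_mul_of_pos_left N henv.base_pos
  have hdle : a / (n + 1) ^ i ≤ a := Nat.div_le_self _ _
  have hdd : a / (n + 1) ^ i / (n + 1) ≤ a / (n + 1) ^ i := Nat.div_le_self _ _
  have hmod : a / (n + 1) ^ i % (n + 1) < n + 1 := Nat.mod_lt _ (by omega)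
  have hdiv : a / (n + 1) ^ i / (n + 1) = a / (n + 1) ^ (i + 1) := by
    rw [Nat.div_div_eq_div_mul, pow_succ]
  have hWz : (X : ℤ) + 4 * (n + 1) + 4 * (((n + 1) * N : ℕ) : ℤ) + |d| ≤ W := by
    rw [Int.abs_eq_natAbs]; exact_mod_cast hword
  have hd := abs_le.1 (le_refl |d|)
  unfold checkDigitProg
  refine Runs.seq (runs_divProg henv.one henv.base henv.base_pos h2 (by omega))
    (T₂ := 5) (by omega) ?_
  rintro s₁ ⟨hF₁, h0₁, h2₁, hm₁⟩
  have henv₁ := henv.frame hF₁ (by norm_num)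
  have hn₁ : s₁.reg rN = n := by rw [henv₁.n]; push_cast; ring
  have h7₁ := hF₁ 7 (by norm_num)
  rw [hdiv] at h0₁ hdd
  set q := a / (n + 1) ^ (i + 1)
  set r := a / (n + 1) ^ i % (n + 1) with hr
  refine Runs.seq_sub ?_ (Runs.seq_sub ?_ ?_)
  · rw [hn₁, henv₁.bound, abs_le]; omega
  · simp only [State.reg_setReg]; norm_num only [if_true, if_false]
    rw [hn₁, henv₁.bound, h2₁, abs_le]; omega
  set s₂ := State.setReg _ 1 _ with hs₂
  have hF₂ : Frame 3 s₁ s₂ := by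
    rw [hs₂]; exact ((Frame.refl _ _).setReg (by norm_num)).setReg (by norm_num)
  have h1₂ : s₂.reg 1 = n - d - r := by simp [hs₂, State.reg_setReg, hn₁, henv₁.bound, h2₁]
  have h0₂ : s₂.reg 0 = q := by simp [hs₂, State.reg_setReg, h0₁]
  have h7₂ : s₂.reg 7 = s.reg 7 := (hF₂ 7 (by norm_num)).trans h7₁
  have hF₂' := ((hF₁.trans hF₂).mono (show 3 ≤ 8 by norm_num))
  have hm₂ : s₂.mem = s.mem := by simp [hs₂, hm₁]
  have hall : (∀ j < i + 1, (n : ℤ) ≤ (a / (n + 1) ^ j % (n + 1) : ℕ) + d) ↔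
      (∀ j < i, (n : ℤ) ≤ (a / (n + 1) ^ j % (n + 1) : ℕ) + d) ∧ (n : ℤ) ≤ r + d := by
    constructor
    · exact fun H => ⟨fun j hj => H j (by omega), H i (by omega)⟩
    · rintro ⟨H, H'⟩ j hj
      rcases Nat.lt_succ_iff_lt_or_eq.1 hj with hj | rfl
      exacts [H j hj, H']
  refine Runs.seq (T₁ := 2) (T₂ := 1) (R := fun s' => Frame 8 s s' ∧ s'.mem = s.mem ∧
      s'.reg 0 = q ∧
      ((s'.reg 7 = 1 ∧ ∀ j < i + 1, (n : ℤ) ≤ (a / (n + 1) ^ j % (n + 1) : ℕ) + d) ∨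
      (s'.reg 7 = 0 ∧ ¬ ∀ j < i + 1, (n : ℤ) ≤ (a / (n + 1) ^ j % (n + 1) : ℕ) + d)))
    (Runs.ifPos (fun hpos => ?_) (fun hneg => ?_)) (by omega) ?_
  · refine Runs.const (T := 0) (by simp) ⟨hF₂'.setReg (by norm_num), hm₂,
      by simpa [State.reg_setReg] using h0₂, Or.inr ⟨by simp [State.reg_setReg], fun H => ?_⟩⟩
    have := (hall.1 H).2
    omega
  · refine Runs.nop (T := 0) ⟨hF₂', hm₂, h0₂, ?_⟩
    rw [h7₂]
    rcases h7 with ⟨e, H⟩ | ⟨e, H⟩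
    · exact Or.inl ⟨e, hall.2 ⟨H, by omega⟩⟩
    · exact Or.inr ⟨e, fun H' => H (hall.1 H').1⟩
  · rintro s₃ ⟨hF₃, hm₃, h0₃, h7₃⟩
    have henv₃ := henv.frame hF₃ (by norm_num)
    refine Runs.add (T := 0) ?_ ⟨hF₃.setReg (by norm_num), hm₃, ?_, ?_⟩
    · rw [h0₃, henv₃.zero, add_zero, Nat.abs_cast]; exact_mod_cast (by omega)
    · simp [State.reg_setReg, h0₃, henv₃.zero]
    · simpa [State.reg_setReg] using h7₃

theorem runs_answerProg {k W n N X : ℕ} {d : ℤ} {inp : ℕ → ℤ} {pa sz : ℕ → ℕ}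
    {F : ℕ → Set ℕ} {s : State} (henv : Env W (n + 1) N X d s) (hkW : k ≤ W)
    (hF0 : ∀ a ∈ F 0, a < N) (hmem : s.mem = memOf (n + 1) N X inp pa sz F) :
    Runs W (answerProg k) s (N * (k * (4 * N + 11) + 11) + 4) (fun s' =>
      ((∃ a ∈ F 0, ∀ j < k, (n : ℤ) ≤ (a / (n + 1) ^ j % (n + 1) : ℕ) + d) → s'.reg 0 = 1) ∧
      ((¬ ∃ a ∈ F 0, ∀ j < k, (n : ℤ) ≤ (a / (n + 1) ^ j % (n + 1) : ℕ) + d) →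
        s'.reg 0 = 0)) := by
  have hword := henv.word
  have hBN : N ≤ (n + 1) * N := Nat.le_mul_of_pos_left N henv.base_pos
  have hWz : (N : ℤ) ≤ W := by exact_mod_cast (by omega)
  unfold answerProg
  refine Runs.seq_const (by simp) (Runs.seq_add ?_ ?_)
  · simp only [State.reg_setReg]; norm_num only [if_false]
    rw [henv.len, henv.zero, add_zero, Nat.abs_cast]; exact hWz
  set s₁ := State.setReg _ 12 _ with hs₁
  have hF₁ : Frame 13 s s₁ := by
    rw [hs₁]; exact ((Frame.refl _ _).setReg (by norm_num)).setReg (by norm_num)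
  have henv₁ := henv.frame hF₁ (by norm_num)
  let good : ℕ → Prop := fun a => ∀ j < k, (n : ℤ) ≤ (a / (n + 1) ^ j % (n + 1) : ℕ) + d
  let res : ℕ → State → Prop := fun j s' =>
    (s'.reg 11 = 1 ∧ ∃ a ∈ F 0, j ≤ a ∧ good a) ∨ (s'.reg 11 = 0 ∧ ¬ ∃ a ∈ F 0, j ≤ a ∧ good a)
  refine Runs.seq (T₂ := 1) (Runs.forDown (m := N) (C := k * (4 * N + 11) + 9)
    (fun j s' => s'.mem = s.mem ∧ res j s') (by norm_num) henv₁.one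
    (by simp [hs₁, State.reg_setReg, henv.len, henv.zero]) (by omega) ⟨by simp [hs₁], ?_⟩ ?_ ?_)
    (le_of_eq (by ring)) ?_
  · refine Or.inr ⟨by simp [hs₁, State.reg_setReg], ?_⟩
    rintro ⟨a, ha, hNa, -⟩
    exact absurd (hF0 a ha) (by omega)
  · rintro j s' v ⟨h1, h2⟩
    exact ⟨h1, by simpa [res, State.reg_setReg] using h2⟩
  · rintro a ha s₂ hF₂ h12₂ ⟨hm₂, hres₂⟩
    have henv₂ := henv₁.frame hF₂ (by norm_num)
    -- The summand `0 * N` puts the address into the form of `memOf_table_pos` for table `0`.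
    have e : s₂.reg rZ + s₂.reg 12 = (X + 2 * (n + 1) + 0 * N + a : ℕ) := by
      rw [henv₂.table, h12₂]; push_cast; ring
    have hskip : ¬ (a ∈ F 0 ∧ good a) → res (a + 1) s₂ → res a s₂ := by
      have hiff : ¬ (a ∈ F 0 ∧ good a) →
          ((∃ b ∈ F 0, a + 1 ≤ b ∧ good b) ↔ ∃ b ∈ F 0, a ≤ b ∧ good b) := by
        intro hna
        constructor
        · rintro ⟨b, hb, hab, hg⟩; exact ⟨b, hb, by omega, hg⟩
        · rintro ⟨b, hb, hab, hg⟩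
          rcases hab.eq_or_lt with rfl | hab
          · exact absurd ⟨hb, hg⟩ hna
          · exact ⟨b, hb, hab, hg⟩
      intro hna H
      simpa only [res, hiff hna] using H
    refine Runs.seq_add ?_ (Runs.seq_load (a := X + 2 * (n + 1) + 0 * N + a) ?_
      (Runs.ifPos (T := k * (4 * N + 11) + 6) (fun hpos => ?_) (fun hneg => ?_)))
    · rw [e, Nat.abs_cast]; exact_mod_cast (by omega)
    · simp only [State.reg_setReg, if_true]
      rw [e]
    · simp only [State.reg_setReg, State.mem_setReg, if_true] at hpos
      rw [hm₂, hmem, memOf_table_pos ha] at hpos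
      refine Runs.seq_add ?_ (Runs.seq_const ?_ (Runs.seq_const ?_ ?_))
      · simp only [State.reg_setReg]; norm_num only [if_false]
        rw [henv₂.zero, h12₂, add_zero, Nat.abs_cast]; exact_mod_cast (by omega)
      · rw [abs_one]; exact_mod_cast (by omega)
      · rw [Nat.abs_cast]; exact_mod_cast hkW
      set s₃ := State.setReg _ 8 _ with hs₃
      have hF₃ : Frame 11 s₂ s₃ := by
        rw [hs₃]
        exact (((((Frame.refl _ _).setReg (by norm_num)).setReg (by norm_num)).setReg
          (by norm_num)).setReg (by norm_num)).setReg (by norm_num)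
      have henv₃ := henv₂.frame hF₃ (by norm_num)
      refine Runs.seq (T₂ := 2) (Runs.forDown (m := k) (C := 4 * N + 9) (fun j s' =>
        s'.mem = s.mem ∧ s'.reg 2 = (a / (n + 1) ^ (k - j) : ℕ) ∧
        ((s'.reg 7 = 1 ∧ ∀ i < k - j, (n : ℤ) ≤ (a / (n + 1) ^ i % (n + 1) : ℕ) + d) ∨
        (s'.reg 7 = 0 ∧ ¬ ∀ i < k - j, (n : ℤ) ≤ (a / (n + 1) ^ i % (n + 1) : ℕ) + d)))
        (by norm_num) henv₃.one (by simp [hs₃, State.reg_setReg]) hkW ⟨?_, ?_, ?_⟩ ?_ ?_)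
        (le_of_eq (by ring)) ?_
      · simp [hs₃, hm₂]
      · simp [hs₃, State.reg_setReg, h12₂, henv₂.zero]
      · exact Or.inl ⟨by simp [hs₃, State.reg_setReg], by simp⟩
      · rintro j s' v ⟨h1, h2, h3⟩
        exact ⟨h1, by simpa [State.reg_setReg] using h2, by simpa [State.reg_setReg] using h3⟩
      · rintro j hj s₄ hF₄ - ⟨h1, h2, h3⟩
        rw [show k - j = k - (j + 1) + 1 by omega]
        refine Runs.mono (runs_checkDigitProg (henv₃.frame hF₄ (by norm_num)) ha h2 h3) le_rfl ?_
        rintro s₅ ⟨hF₅, hm₅, h2₅, h7₅⟩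
        exact ⟨hF₅, hm₅.trans h1, h2₅, h7₅⟩
      · rintro s₄ ⟨hF₄, hm₄, -, h7₄⟩
        have hF₄' : Frame 11 s₂ s₄ := hF₃.trans (hF₄.mono (by norm_num))
        refine Runs.ifPos (fun hp => ?_) (fun hn => ?_)
        · refine Runs.const (T := 0) (by rw [abs_one]; exact_mod_cast (by omega))
            ⟨(hF₄'.mono (by norm_num)).setReg (by norm_num), hm₄, Or.inl
              ⟨by simp [State.reg_setReg], a, hpos, le_rfl, ?_⟩⟩
          rcases h7₄ with ⟨-, H⟩ | ⟨e0, -⟩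
          · simpa [good] using H
          · omega
        · refine Runs.nop (T := 0) ⟨hF₄'.mono (by norm_num), hm₄, ?_⟩
          have hres : res a s₂ := hskip (fun H => ?_) hres₂
          · simpa only [res, hF₄' 11 le_rfl] using hres
          · rcases h7₄ with ⟨e1, -⟩ | ⟨-, H'⟩
            · omega
            · exact H' (by simpa [good] using H.2)
    · simp only [State.reg_setReg, State.mem_setReg, if_true] at hneg
      rw [← not_lt, hm₂, hmem, memOf_table_pos ha] at hneg
      refine Runs.nop ⟨((Frame.refl _ _).setReg (by norm_num)).setReg (by norm_num), hm₂, ?_⟩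
      simpa [res, State.reg_setReg] using hskip (fun H => hneg H.1) hres₂
  · rintro s₂ ⟨hF₂, hm₂, hres₂⟩
    have henv₂ := henv₁.frame hF₂ (by norm_num)
    have hres : (s₂.reg 11 = 1 ∧ ∃ a ∈ F 0, good a) ∨ (s₂.reg 11 = 0 ∧ ¬ ∃ a ∈ F 0, good a) := by
      simpa [res] using hres₂
    refine Runs.add (T := 0) ?_ ?_
    · rw [henv₂.zero, add_zero]
      rcases hres with ⟨e, -⟩ | ⟨e, -⟩ <;> rw [e]
      · rw [abs_one]; exact_mod_cast (by omega)
      · simp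
    · simp only [State.reg_setReg, if_true, henv₂.zero, add_zero]
      rcases hres with ⟨e, H⟩ | ⟨e, H⟩
      · exact ⟨fun _ => e, fun H' => absurd H H'⟩
      · exact ⟨fun H' => absurd H' H, fun _ => e⟩

/-! ### Reading the input -/

theorem getD_flatMap_arcs {n : ℕ} (arcs : List (Fin n × Fin n)) {e : ℕ} (he : e < arcs.length) :
    (arcs.flatMap fun e => [((e.1 : ℕ) : ℤ), ((e.2 : ℕ) : ℤ)]).getD (2 * e) 0 = (arcs[e].1 : ℕ) ∧
    (arcs.flatMap fun e => [((e.1 : ℕ) : ℤ), ((e.2 : ℕ) : ℤ)]).getD (2 * e + 1) 0 =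
      (arcs[e].2 : ℕ) := by
  induction arcs generalizing e with
  | nil => simp at he
  | cons a l ih =>
    cases e with
    | zero => simp
    | succ e =>
      have := ih (e := e) (by simpa using he)
      simpa [Nat.mul_add] using this

theorem length_flatMap_arcs {n : ℕ} (arcs : List (Fin n × Fin n)) :
    (arcs.flatMap fun e => [((e.1 : ℕ) : ℤ), ((e.2 : ℕ) : ℤ)]).length = 2 * arcs.length := by
  induction arcs with
  | nil => rfl
  | cons a l ih => simp only [List.flatMap_cons, List.length_append, ih]; simp; omega

theorem initialState_mem_arc {n : ℕ} (arcs : List (Fin n × Fin n)) (d : ℤ) {e : ℕ}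
    (he : e < arcs.length) :
    (initialState arcs d).mem (3 + 2 * e) = (arcs[e].1 : ℕ) ∧
    (initialState arcs d).mem (3 + 2 * e + 1) = (arcs[e].2 : ℕ) := by
  have := getD_flatMap_arcs arcs he
  simp only [initialState, inputWords]
  rw [show 3 + 2 * e = 2 * e + 1 + 1 + 1 by ring,
    show 2 * e + 1 + 1 + 1 + 1 = (2 * e + 1) + 1 + 1 + 1 by ring]
  simpa using this

/-- Cells beyond the input are zero, so they already encode zero arrays and empty tables. -/
theorem initialState_mem_eq_memOf {n : ℕ} (arcs : List (Fin n × Fin n)) (d : ℤ) (B N : ℕ) :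
    (initialState arcs d).mem = memOf B N (3 + 2 * arcs.length) (initialState arcs d).mem
      (fun _ => 0) (fun _ => 0) (fun _ => ∅) := by
  funext a
  unfold memOf
  split_ifs with h1 h2 h3 h4
  · rfl
  all_goals try exact h4.elim
  all_goals
    simp only [initialState, inputWords]
    rw [List.getD_eq_default _ _ (by simp only [List.length_cons, length_flatMap_arcs]; omega)]
  · rfl
  · rfl

/-- Read the parameters of the input and set the registers with a fixed meaning. -/
def setupProg (k : ℕ) : Prog :=
  .seq (.const rOne 1) (.seq (.load rN rZero) (.seq (.load rM rOne) (.seq (.add 2 rOne rOne)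
    (.seq (.load rD 2) (.seq (.add rB rN rOne) (.seq (.add rX rM rM) (.seq (.add rX rX 2)
    (.seq (.add rX rX rOne) (.seq (.add rY rX rB) (.seq (.add rZ rY rB) (.seq (.const 5 1)
    (.seq (.const 10 k) (.seq (forDown 10 (.seq (mulProg rB 5) (.add 5 0 rZero)))
    (.add rL 5 rZero))))))))))))))

/-- Register `rZero` is never written and keeps its initial zero. The table length is built by `k`
multiplications by the base, each linear in `n`. -/
theorem runs_setupProg {k n W : ℕ} {d : ℤ} {arcs : List (Fin n × Fin n)} (hkW : k ≤ W)
    (hW : 3 + 2 * arcs.length + 4 * (n + 1) + 4 * ((n + 1) * (n + 1) ^ k) + d.natAbs ≤ W) :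
    Runs W (setupProg k) (initialState arcs d) (k * (3 * (n + 1) + 6) + 15) (fun s' =>
      Env W (n + 1) ((n + 1) ^ k) (3 + 2 * arcs.length) d s' ∧ s'.reg rM = arcs.length ∧
      s'.mem = (initialState arcs d).mem) := by
  have hpow : ∀ i ≤ k, (n + 1) ^ i ≤ (n + 1) ^ k := fun i hi => Nat.pow_le_pow_right (by omega) hi
  have hBN : (n + 1) ^ k ≤ (n + 1) * (n + 1) ^ k := Nat.le_mul_of_pos_left _ (by omega)
  have hWz : (3 : ℤ) + 2 * arcs.length + 4 * (n + 1) + 4 * (((n + 1) * (n + 1) ^ k : ℕ) : ℤ) ≤ W := by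
    exact_mod_cast (by omega)
  have hm0 : (initialState arcs d).mem 0 = n := by simp [initialState, inputWords]
  have hm1 : (initialState arcs d).mem 1 = arcs.length := by simp [initialState, inputWords]
  have hm2 : (initialState arcs d).mem 2 = d := by simp [initialState, inputWords]
  have hr : ∀ x, (initialState arcs d).reg x = 0 := fun x => rfl
  unfold setupProg
  refine Runs.seq_const (by rw [abs_one]; omega) (Runs.seq_load (a := 0) ?_
    (Runs.seq_load (a := 1) ?_ (Runs.seq_add ?_ (Runs.seq_load (a := 2) ?_ (Runs.seq_add ?_
    (Runs.seq_add ?_ (Runs.seq_add ?_ (Runs.seq_add ?_ (Runs.seq_add ?_ (Runs.seq_add ?_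
    (Runs.seq_const (by rw [abs_one]; omega) (Runs.seq_const ?_ ?_))))))))))))
  · simp [State.reg_setReg, hr]
  · simp [State.reg_setReg]
  · simp [State.reg_setReg]; omega
  · simp [State.reg_setReg]
  · simp [State.reg_setReg, hm0, abs_le]; omega
  · simp [State.reg_setReg, hm1, abs_le]; omega
  · simp [State.reg_setReg, hm1, abs_le]; omega
  · simp [State.reg_setReg, hm1, abs_le]; omega
  · simp [State.reg_setReg, hm1, hm0, abs_le]; omega
  · simp [State.reg_setReg, hm1, hm0, abs_le]; omega
  · rw [Nat.abs_cast]; exact_mod_cast hkW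
  set s₁ := State.setReg _ 10 _ with hs₁
  have hone : s₁.reg rOne = 1 := by simp [hs₁, State.reg_setReg]
  have hzero : s₁.reg rZero = 0 := by simp [hs₁, State.reg_setReg, hr]
  have hB : s₁.reg rB = (n + 1 : ℕ) := by simp [hs₁, State.reg_setReg, hm0]
  have hn : s₁.reg rN = n := by simp [hs₁, State.reg_setReg, hm0]
  have hM : s₁.reg rM = arcs.length := by simp [hs₁, State.reg_setReg, hm1]
  have hD : s₁.reg rD = d := by simp [hs₁, State.reg_setReg, hm2]
  have hX : s₁.reg rX = 3 + 2 * arcs.length := by simp [hs₁, State.reg_setReg, hm1]; ring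
  have hY : s₁.reg rY = 3 + 2 * arcs.length + (n + 1) := by
    simp [hs₁, State.reg_setReg, hm1, hm0]; ring
  have hZ : s₁.reg rZ = 3 + 2 * arcs.length + 2 * (n + 1) := by
    simp [hs₁, State.reg_setReg, hm1, hm0]; ring
  have hm : s₁.mem = (initialState arcs d).mem := by simp [hs₁]
  refine Runs.seq (T₂ := 1) (Runs.forDown (m := k) (C := 3 * (n + 1) + 4)
    (fun j s' => s'.mem = s₁.mem ∧ s'.reg 5 = ((n + 1) ^ (k - j) : ℕ)) (by norm_num) hone
    (by simp [hs₁, State.reg_setReg]) hkW ⟨rfl, by simp [hs₁, State.reg_setReg]⟩ ?_ ?_)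
    (le_of_eq (by ring)) ?_
  · rintro j s' v ⟨h1, h2⟩
    exact ⟨h1, by simpa [State.reg_setReg] using h2⟩
  · rintro j hj s₂ hF₂ - ⟨h1, h2⟩
    have e : (n + 1) * (n + 1) ^ (k - (j + 1)) = (n + 1) ^ (k - j) := by
      rw [show k - j = k - (j + 1) + 1 by omega, pow_succ, mul_comm]
    have hle := hpow (k - j) (by omega)
    have hzero₂ : s₂.reg rZero = 0 := (hF₂ _ (by norm_num)).trans hzero
    refine Runs.seq (T₂ := 1) (runs_mulProg (by norm_num) (by norm_num)
      ((hF₂ _ (by norm_num)).trans hone) hzero₂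
      ((hF₂ _ (by norm_num)).trans hB) h2 (by rw [e]; omega) (by omega)) (by omega) ?_
    rintro s₃ ⟨hF₃, h0₃, hm₃⟩
    have hzero₃ : s₃.reg rZero = 0 := (hF₃ _ (by norm_num)).trans hzero₂
    rw [e] at h0₃
    refine Runs.add (T := 0) ?_ ⟨(hF₃.mono (by norm_num)).setReg (by norm_num), ?_, ?_⟩
    · rw [h0₃, hzero₃, add_zero, Nat.abs_cast]; exact_mod_cast (by omega)
    · exact hm₃.trans h1
    · simp only [State.reg_setReg, if_true]
      rw [h0₃, hzero₃, add_zero]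
  · rintro s₂ ⟨hF₂, hm₂, h5₂⟩
    rw [Nat.sub_zero] at h5₂
    have hzero₂ : s₂.reg rZero = 0 := (hF₂ _ (by norm_num)).trans hzero
    refine Runs.add (T := 0) ?_ ⟨⟨?_, ?_, ?_, ?_, ?_, ?_, ?_, ?_, ?_, by omega, by positivity, hW⟩,
      ?_, hm₂.trans hm⟩
    · rw [h5₂, hzero₂, add_zero, Nat.abs_cast]; exact_mod_cast (by omega)
    all_goals
      simp only [State.reg_setReg]
      norm_num only [if_true, if_false]
    · rw [hF₂ _ (by norm_num), hn]; push_cast; ring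
    · rw [hF₂ _ (by norm_num), hD]
    · rw [hF₂ _ (by norm_num), hone]
    · exact hzero₂
    · rw [hF₂ _ (by norm_num), hB]
    · rw [h5₂, hzero₂, add_zero]
    · rw [hF₂ _ (by norm_num), hX]; push_cast; rfl
    · rw [hF₂ _ (by norm_num), hY]; push_cast; rfl
    · rw [hF₂ _ (by norm_num), hZ]; push_cast; rfl
    · rw [hF₂ _ (by norm_num), hM]

/-! ### The array of parents -/

/-- The array of parents that results from a list of arcs. -/
def parentOf {n : ℕ} : List (Fin n × Fin n) → ℕ → ℕ
  | [] => fun _ => 0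
  | e :: l => Function.update (parentOf l) (e.2 + 1) (e.1 + 1)

theorem parentOf_spec {n : ℕ} (l : List (Fin n × Fin n)) (v : Fin n) :
    (∃ u : Fin n, (u, v) ∈ l ∧ parentOf l (v + 1) = u + 1) ∨
      (parentOf l (v + 1) = 0 ∧ ∀ u, (u, v) ∉ l) := by
  induction l with
  | nil => simp [parentOf]
  | cons e l ih =>
    by_cases he : v = e.2
    · subst he
      exact Or.inl ⟨e.1, by simp, by simp [parentOf]⟩
    · have : (v : ℕ) + 1 ≠ e.2 + 1 := fun h => he (Fin.ext (by omega))
      rw [parentOf, Function.update_of_ne this]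
      rcases ih with ⟨u, hu, h⟩ | ⟨h, hn⟩
      · exact Or.inl ⟨u, List.mem_cons_of_mem _ hu, h⟩
      · refine Or.inr ⟨h, fun u hu => ?_⟩
        rcases List.mem_cons.1 hu with hu | hu
        · exact he (by rw [← hu])
        · exact hn u hu

theorem IsArcList.isParentMap {n : ℕ} {G : Digraph (Fin n)} {arcs : List (Fin n × Fin n)}
    (h : IsArcList G arcs) : IsParentMap G (parentOf arcs) := by
  intro v
  rcases parentOf_spec arcs v with ⟨u, hu, e⟩ | ⟨e, hn⟩
  · exact Or.inl ⟨u, (h.2 u v).1 hu, e⟩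
  · exact Or.inr ⟨e, fun u hu => hn u ((h.2 u v).2 hu)⟩

/-- Fill in the array of parents. -/
def parentProg : Prog :=
  .seq (.add 10 rM rZero) (forDown 10 (.seq (.add 5 10 10) (.seq (.add 6 rOne rOne)
    (.seq (.add 6 6 rOne) (.seq (.add 5 6 5) (.seq (.load 7 5) (.seq (.add 5 5 rOne)
    (.seq (.load 8 5) (.seq (.add 7 7 rOne) (.seq (.add 8 8 rOne) (.seq (.add 8 rX 8)
    (.store 8 7))))))))))))

theorem runs_parentProg {n N W : ℕ} {d : ℤ} {arcs : List (Fin n × Fin n)} {s : State}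
    (henv : Env W (n + 1) N (3 + 2 * arcs.length) d s) (hM : s.reg rM = arcs.length)
    (hmem : s.mem = (initialState arcs d).mem) :
    Runs W parentProg s (arcs.length * 13 + 2) (fun s' => Frame 11 s s' ∧
      s'.mem = memOf (n + 1) N (3 + 2 * arcs.length) (initialState arcs d).mem (parentOf arcs)
      (fun _ => 0) (fun _ => ∅)) := by
  have hword := henv.word
  have hWz : (3 : ℤ) + 2 * arcs.length + 4 * (n + 1) ≤ W := by exact_mod_cast (by omega)
  unfold parentProg
  refine Runs.seq_add ?_ ?_
  · rw [hM, henv.zero, add_zero, Nat.abs_cast]; omega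
  set s₁ := State.setReg _ 10 _ with hs₁
  have hF₁ : Frame 11 s s₁ := (Frame.refl _ _).setReg (by norm_num)
  have henv₁ := henv.frame hF₁ (by norm_num)
  -- The arcs are read from the last to the first, matching the recursion of `parentOf`, in which
  -- the head of the list is written last.
  refine Runs.mono (Runs.forDown (m := arcs.length) (C := 11) (fun j s' => s'.mem =
    memOf (n + 1) N (3 + 2 * arcs.length) (initialState arcs d).mem (parentOf (arcs.drop j))
      (fun _ => 0) (fun _ => ∅)) (by norm_num) henv₁.one
    (by simp [hs₁, State.reg_setReg, hM, henv.zero]) (by omega) ?_ (fun _ _ _ h => h) ?_) le_rfl ?_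
  · rw [List.drop_length, parentOf, ← initialState_mem_eq_memOf]; simpa [hs₁] using hmem
  · rintro j hj s₂ hF₂ h10 hm₂
    have henv₂ := henv₁.frame hF₂ (by norm_num)
    obtain ⟨ht, hh⟩ := initialState_mem_arc arcs d hj
    have ht' : s₂.mem (3 + 2 * j) = (arcs[j].1 : ℕ) := by
      rw [hm₂, memOf_inp (by omega), ht]
    have hh' : s₂.mem (3 + 2 * j + 1) = (arcs[j].2 : ℕ) := by
      rw [hm₂, memOf_inp (by omega), hh]
    have hone := henv₂.one
    have hX := henv₂.par
    have hlt1 := arcs[j].1.2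
    have hlt2 := arcs[j].2.2
    refine Runs.seq_add ?_ (Runs.seq_add ?_ (Runs.seq_add ?_ (Runs.seq_add ?_
      (Runs.seq_load (a := 3 + 2 * j) ?_ (Runs.seq_add ?_ (Runs.seq_load (a := 3 + 2 * j + 1) ?_
      (Runs.seq_add ?_ (Runs.seq_add ?_ (Runs.seq_add ?_ (Runs.store (T := 0)
      (a := 3 + 2 * arcs.length + (arcs[j].2 + 1)) ?_ ⟨?_, ?_⟩))))))))))
    · rw [h10, abs_le]; omega
    · simp [State.reg_setReg, hone]; omega
    · simp [State.reg_setReg, hone]; omega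
    · simp [State.reg_setReg, hone, h10, abs_le]; omega
    · simp [State.reg_setReg, hone, h10]; ring
    · simp [State.reg_setReg, hone, h10, abs_le]; omega
    · simp [State.reg_setReg, hone, h10]; ring
    · simp [State.reg_setReg, hone, ht', abs_le]; omega
    · simp [State.reg_setReg, hone, hh', abs_le]; omega
    · simp [State.reg_setReg, hone, hX, hh', abs_le]; omega
    · simp [State.reg_setReg, hone, hX, hh']
    · repeat' first | exact Frame.refl _ _ | refine Frame.setMem ?_ | refine Frame.setReg ?_ (by norm_num)
    · simp only [State.mem_setMem, State.mem_setReg, State.reg_setReg]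
      norm_num only [if_true, if_false]
      rw [ht', hone, hm₂, show ((arcs[j].1 : ℕ) : ℤ) + 1 = ((arcs[j].1 + 1 : ℕ) : ℤ) by push_cast; rfl,
        update_memOf_par (by omega), List.drop_eq_getElem_cons hj, parentOf]
  · rintro s₂ ⟨hF₂, hm₂⟩
    exact ⟨hF₁.trans hF₂, by simpa using hm₂⟩

/-! ### The array of subtree sizes -/

section Sizes

open Relation

/-- Increase the sizes of all ancestors of the item in register `9`. -/
def climbProg : Prog :=
  .whilePos 9 (.seq (.add 5 rY 9) (.seq (.load 6 5) (.seq (.add 6 6 rOne) (.seq (.store 5 6)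
    (.seq (.add 5 rX 9) (.load 9 5))))))

-- The parent numbers lead from `v` through exactly its ancestors and end at the virtual root `0`,
-- where the loop stops. The induction goes up to the parent and is general in `sz` and `s`, as each
-- round alters them.
open Classical in
theorem runs_climbProg {n N W X : ℕ} {d : ℤ} {G : Digraph (Fin n)} {inp : ℕ → ℤ} {pa : ℕ → ℕ}
    {F : ℕ → Set ℕ} (h : IsOutForest G) (hpa : IsParentMap G pa) (v : Fin n) :
    ∀ (sz : ℕ → ℕ) (s : State), Env W (n + 1) N X d s → s.reg 9 = (v + 1 : ℕ) →
      s.mem = memOf (n + 1) N X inp pa sz F →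
      (∀ y : Fin n, ReflTransGen G.Adj y v → sz (y + 1) + 1 ≤ W) →
      Runs W climbProg s ({y | ReflTransGen G.Adj y v}.ncard * 7 + 1) (fun s' => Frame 10 s s' ∧
        s'.mem = memOf (n + 1) N X inp pa
        (fun x => sz x + if ∃ y : Fin n, x = y + 1 ∧ ReflTransGen G.Adj y v then 1 else 0) F) := by
  have : Std.Irrefl (TransGen G.Adj) := ⟨h.isAcyclic⟩
  have hwf : WellFounded (TransGen G.Adj) := Finite.wellFounded_of_trans_of_irrefl _
  induction v using hwf.induction with
  | _ v ih =>
  intro sz s henv h9 hmem hsz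
  have hword := henv.word
  have hw : (v : ℕ) + 1 < n + 1 := by omega
  have e₁ : s.reg rY + s.reg 9 = (X + (n + 1) + (v + 1) : ℕ) := by
    rw [henv.sz, h9]; push_cast; ring
  have e₂ : s.reg rX + s.reg 9 = (X + (v + 1) : ℕ) := by rw [henv.par, h9]; push_cast; ring
  have hszv : s.mem (X + (n + 1) + (v + 1)) = sz (v + 1) := by rw [hmem, memOf_sz hw]
  have hone := henv.one
  let sz' := Function.update sz (v + 1) (sz (v + 1) + 1)
  have step : Runs W (.seq (.add 5 rY 9) (.seq (.load 6 5) (.seq (.add 6 6 rOne)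
      (.seq (.store 5 6) (.seq (.add 5 rX 9) (.load 9 5)))))) s 6 (fun s' => Frame 10 s s' ∧
      s'.reg 9 = pa (v + 1) ∧ s'.mem = memOf (n + 1) N X inp pa sz' F) := by
    have hmem' : Function.update s.mem (X + (n + 1) + (v + 1)) ((sz (v + 1) : ℤ) + 1) =
        memOf (n + 1) N X inp pa sz' F := by
      rw [hmem, show (sz (v + 1) : ℤ) + 1 = ((sz (v + 1) + 1 : ℕ) : ℤ) by push_cast; rfl,
        update_memOf_sz hw]
    refine Runs.seq_add ?_ (Runs.seq_load (a := X + (n + 1) + (v + 1)) ?_ (Runs.seq_add ?_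
      (Runs.seq_store (a := X + (n + 1) + (v + 1)) ?_ (Runs.seq_add ?_
      (Runs.load (T := 0) (a := X + (v + 1)) ?_ ⟨?_, ?_, ?_⟩)))))
    · rw [e₁, Nat.abs_cast]; exact_mod_cast (by omega)
    · simp only [State.reg_setReg, if_true]; rw [e₁]
    · simp only [State.reg_setReg, State.mem_setReg]; norm_num only [if_true, if_false]
      rw [hszv, hone]
      have := hsz v .refl
      rw [abs_le]; omega
    · simp only [State.reg_setReg]; norm_num only [if_true, if_false]; rw [e₁]
    · simp only [State.reg_setReg, State.reg_setMem]; norm_num only [if_true, if_false]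
      rw [e₂, Nat.abs_cast]; exact_mod_cast (by omega)
    · simp only [State.reg_setReg, State.reg_setMem]; norm_num only [if_true, if_false]
      rw [e₂]
    · repeat' first | exact Frame.refl _ _ | refine Frame.setMem ?_ | refine Frame.setReg ?_ (by norm_num)
    · simp only [State.mem_setMem, State.mem_setReg, State.reg_setReg, if_true]
      norm_num only [if_true, if_false]
      rw [hszv, hone, hmem', memOf_par hw]
    · simp only [State.mem_setMem, State.mem_setReg, State.reg_setReg]
      norm_num only [if_true, if_false]
      rw [hszv, hone, hmem']
  have hpos : 0 < s.reg 9 := by rw [h9]; exact_mod_cast Nat.succ_pos _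
  rcases hpa v with ⟨u, huv, hu⟩ | ⟨h0, hroot⟩
  · have hset : {y | ReflTransGen G.Adj y v} = insert v {y | ReflTransGen G.Adj y u} := by
      ext y; constructor
      · intro hy
        rcases ReflTransGen.cases_tail hy with e | ⟨p, hyp, hpv⟩
        · exact Or.inl e.symm
        · exact Or.inr (by rw [h.adj_unique huv hpv]; exact hyp)
      · rintro (rfl | hy)
        · exact .refl
        · exact hy.tail huv
    have hvu : ¬ ReflTransGen G.Adj v u := fun hr => h.isAcyclic v (TransGen.tail' hr huv)
    rw [hset, Set.ncard_insert_of_notMem (by simpa using hvu)]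
    refine Runs.while_true hpos step (T₂ := {y | ReflTransGen G.Adj y u}.ncard * 7 + 1)
      (by omega) ?_
    rintro s₁ ⟨hF₁, h9₁, hm₁⟩
    refine Runs.mono (ih u (.single huv) sz' s₁ (henv.frame hF₁ (by norm_num)) (by rw [h9₁, hu])
      hm₁ ?_) le_rfl ?_
    · intro y hy
      have hne : (y : ℕ) + 1 ≠ v + 1 := fun e => hvu (by rwa [show v = y from Fin.ext (by omega)])
      simp only [sz', Function.update_of_ne hne]
      exact hsz y (hy.tail huv)
    · rintro s₂ ⟨hF₂, hm₂⟩
      refine ⟨hF₁.trans hF₂, ?_⟩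
      rw [hm₂]
      congr 1
      funext x
      have hiff : (∃ y : Fin n, x = y + 1 ∧ ReflTransGen G.Adj y v) ↔
          x = v + 1 ∨ ∃ y : Fin n, x = y + 1 ∧ ReflTransGen G.Adj y u := by
        constructor
        · rintro ⟨y, rfl, hy⟩
          rcases (hset ▸ hy : y ∈ insert v {y | ReflTransGen G.Adj y u}) with rfl | hy
          · exact Or.inl rfl
          · exact Or.inr ⟨y, rfl, hy⟩
        · rintro (rfl | ⟨y, rfl, hy⟩)
          · exact ⟨v, rfl, .refl⟩
          · exact ⟨y, rfl, hy.tail huv⟩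
      by_cases hx : x = v + 1
      · have hno : ¬ ∃ y : Fin n, x = y + 1 ∧ ReflTransGen G.Adj y u := by
          rintro ⟨y, hy, hyu⟩
          exact hvu (by rwa [show v = y from Fin.ext (by omega)])
        rw [if_neg hno, if_pos (hiff.2 (Or.inl hx)), hx]
        simp [sz']
      · simp only [hiff, hx, false_or, sz', Function.update_of_ne hx]
  · have hset : {y | ReflTransGen G.Adj y v} = {v} := by
      ext y; constructor
      · intro hy
        rcases ReflTransGen.cases_tail hy with e | ⟨p, -, hpv⟩
        · exact e.symm
        · exact absurd hpv (hroot p)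
      · rintro rfl; exact ReflTransGen.refl
    rw [hset, Set.ncard_singleton]
    refine Runs.while_true hpos step (T₂ := 1) (by omega) ?_
    rintro s₁ ⟨hF₁, h9₁, hm₁⟩
    refine Runs.while_false (T := 0) (by rw [h9₁, h0]; simp) ⟨hF₁, ?_⟩
    rw [hm₁]
    congr 1
    funext x
    have hiff : (∃ y : Fin n, x = y + 1 ∧ ReflTransGen G.Adj y v) ↔ x = v + 1 := by
      constructor
      · rintro ⟨y, rfl, hy⟩
        rw [show y = v from (hset ▸ hy : y ∈ ({v} : Set (Fin n)))]
      · rintro rfl; exact ⟨v, rfl, .refl⟩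
    by_cases hx : x = v + 1
    · rw [if_pos (hiff.2 hx), hx]; simp [sz']
    · rw [if_neg (fun H => hx (hiff.1 H))]; simp [sz', Function.update_of_ne hx]

/-- The subtree sizes when only the items from `j` on are counted. -/
noncomputable def sizesFrom {n : ℕ} (G : Digraph (Fin n)) (j x : ℕ) : ℕ :=
  {u : Fin n | j ≤ u ∧ ∃ v : Fin n, x = v + 1 ∧ ReflTransGen G.Adj v u}.ncard

theorem sizesFrom_le {n : ℕ} (G : Digraph (Fin n)) (j x : ℕ) : sizesFrom G j x ≤ n := by
  simpa [sizesFrom] using Set.ncard_le_card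
    {u : Fin n | j ≤ u ∧ ∃ v : Fin n, x = v + 1 ∧ ReflTransGen G.Adj v u}

theorem sizesFrom_zero {n : ℕ} (G : Digraph (Fin n)) (v : Fin n) :
    sizesFrom G 0 (v + 1) = (subtree G v).card := by
  rw [sizesFrom, ← Set.ncard_coe_finset]
  congr 1
  ext u
  simp only [Set.mem_ofPred_eq, Finset.mem_coe, mem_subtree]
  constructor
  · rintro ⟨-, w, hw, hr⟩
    rwa [show v = w from Fin.ext (by omega)]
  · exact fun hr => ⟨Nat.zero_le _, v, rfl, hr⟩

-- Counting one more item `u` raises the size at each of its ancestors by one, which is what one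
-- climb from `u` adds.
open Classical in
theorem sizesFrom_eq_succ {n : ℕ} (G : Digraph (Fin n)) (u : Fin n) (x : ℕ) :
    sizesFrom G u x = sizesFrom G (u + 1) x +
      if ∃ v : Fin n, x = v + 1 ∧ ReflTransGen G.Adj v u then 1 else 0 := by
  have hle : ∀ y : Fin n, (u : ℕ) ≤ y ↔ y = u ∨ (u : ℕ) + 1 ≤ y := fun y => by
    rw [Fin.ext_iff]; omega
  unfold sizesFrom
  split_ifs with hx
  · rw [← Set.ncard_insert_of_notMem (a := u) (by simp)]
    congr 1
    ext y
    simp only [Set.mem_ofPred_eq, Set.mem_insert_iff, hle y]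
    constructor
    · rintro ⟨rfl | hy, h⟩
      exacts [Or.inl rfl, Or.inr ⟨hy, h⟩]
    · rintro (rfl | ⟨hy, h⟩)
      exacts [⟨Or.inl rfl, hx⟩, ⟨Or.inr hy, h⟩]
  · rw [add_zero]
    congr 1
    ext y
    simp only [Set.mem_ofPred_eq, hle y]
    constructor
    · rintro ⟨rfl | hy, h⟩
      exacts [absurd h hx, ⟨hy, h⟩]
    · rintro ⟨hy, h⟩
      exact ⟨Or.inr hy, h⟩

/-- Fill in the array of subtree sizes. -/
def sizeProg : Prog :=
  .seq (.add 10 rN rZero) (forDown 10 (.seq (.add 9 10 rOne) climbProg))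

theorem runs_sizeProg {n N W X : ℕ} {d : ℤ} {G : Digraph (Fin n)} {inp : ℕ → ℤ} {pa : ℕ → ℕ}
    {F : ℕ → Set ℕ} {s : State} (h : IsOutForest G) (hpa : IsParentMap G pa)
    (henv : Env W (n + 1) N X d s) (hmem : s.mem = memOf (n + 1) N X inp pa (fun _ => 0) F) :
    Runs W sizeProg s (n * (n * 7 + 4) + 2) (fun s' => Frame 11 s s' ∧
      s'.mem = memOf (n + 1) N X inp pa (sizesFrom G 0) F) := by
  have hword := henv.word
  have hn : s.reg rN = n := by rw [henv.n]; push_cast; ring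
  unfold sizeProg
  refine Runs.seq_add ?_ ?_
  · rw [hn, henv.zero, add_zero, Nat.abs_cast]; exact_mod_cast (by omega)
  set s₁ := State.setReg _ 10 _ with hs₁
  have hF₁ : Frame 11 s s₁ := (Frame.refl _ _).setReg (by norm_num)
  have henv₁ := henv.frame hF₁ (by norm_num)
  refine Runs.mono (Runs.forDown (m := n) (C := n * 7 + 2) (fun j s' => s'.mem =
    memOf (n + 1) N X inp pa (sizesFrom G j) F) (by norm_num) henv₁.one
    (by simp [hs₁, State.reg_setReg, hn, henv.zero]) (by omega) ?_ (fun _ _ _ h => h) ?_) le_rfl ?_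
  · rw [hs₁, State.mem_setReg, hmem]
    congr 1
    funext x
    rw [sizesFrom, eq_comm, Set.ncard_eq_zero]
    ext u
    simp only [Set.mem_ofPred_eq, Set.mem_empty_iff_false, iff_false]
    omega
  · rintro j hj s₂ hF₂ h10₂ hm₂
    have henv₂ := henv₁.frame hF₂ (by norm_num)
    have e : s₂.reg 10 + s₂.reg rOne = (j + 1 : ℕ) := by rw [h10₂, henv₂.one]; push_cast; rfl
    refine Runs.seq_add ?_ ?_
    · rw [e, Nat.abs_cast]; exact_mod_cast (by omega)
    have hF₃ : Frame 10 s₂ (s₂.setReg 9 (s₂.reg 10 + s₂.reg rOne)) :=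
      (Frame.refl _ _).setReg (by norm_num)
    have hcard : {y | ReflTransGen G.Adj y ⟨j, hj⟩}.ncard ≤ n := by
      simpa using Set.ncard_le_card {y | ReflTransGen G.Adj y ⟨j, hj⟩}
    refine Runs.mono (runs_climbProg h hpa ⟨j, hj⟩ (sizesFrom G (j + 1)) _
      (henv₂.frame hF₃ (by norm_num)) (by simp only [State.reg_setReg, if_true]; exact e)
      hm₂ fun y _ => ?_) (by omega) ?_
    · have := sizesFrom_le G (j + 1) (y + 1)
      omega
    · rintro s₄ ⟨hF₄, hm₄⟩
      refine ⟨hF₃.trans hF₄, ?_⟩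
      rw [hm₄]
      congr 1
      funext x
      exact (sizesFrom_eq_succ G ⟨j, hj⟩ x).symm
  · rintro s₂ ⟨hF₂, hm₂⟩
    exact ⟨hF₁.trans hF₂, hm₂⟩

end Sizes

/-! ### The initial tables -/

/-- Put zero into each table. -/
def tableProg : Prog :=
  .seq (.add 10 rB rZero) (forDown 10 (.seq (mulProg 10 rL) (.seq (.add 5 rZ 0) (.store 5 rOne))))

theorem runs_tableProg {B N W X : ℕ} {d : ℤ} {inp : ℕ → ℤ} {pa sz : ℕ → ℕ} {s : State}
    (henv : Env W B N X d s) (hmem : s.mem = memOf B N X inp pa sz (fun _ => ∅)) :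
    Runs W tableProg s (B * (3 * B + 7) + 2) (fun s' => Frame 11 s s' ∧
      s'.mem = memOf B N X inp pa sz (fun w => {x | w < B ∧ x = 0})) := by
  have hword := henv.word
  have hBN : N ≤ B * N := Nat.le_mul_of_pos_left N henv.base_pos
  unfold tableProg
  refine Runs.seq_add ?_ ?_
  · rw [henv.base, henv.zero, add_zero, Nat.abs_cast]; exact_mod_cast (by omega)
  set s₁ := State.setReg _ 10 _ with hs₁
  have hF₁ : Frame 11 s s₁ := (Frame.refl _ _).setReg (by norm_num)
  have henv₁ := henv.frame hF₁ (by norm_num)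
  refine Runs.mono (Runs.forDown (m := B) (C := 3 * B + 5) (fun j s' => s'.mem =
    memOf B N X inp pa sz (fun w => {x | (j ≤ w ∧ w < B) ∧ x = 0})) (by norm_num) henv₁.one
    (by simp [hs₁, State.reg_setReg, henv.base, henv.zero]) (by omega) ?_ (fun _ _ _ h => h) ?_)
    le_rfl ?_
  · rw [hs₁, State.mem_setReg, hmem]
    congr 1
    funext w
    ext x
    simp only [Set.mem_ofPred_eq, Set.mem_empty_iff_false, false_iff]
    omega
  · rintro j hj s₂ hF₂ h10₂ hm₂
    have henv₂ := henv₁.frame hF₂ (by norm_num)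
    have hjN : j * N + N ≤ B * N := by
      calc j * N + N = (j + 1) * N := by ring
        _ ≤ B * N := Nat.mul_le_mul_right N hj
    refine Runs.seq (T₂ := 2) (runs_mulProg (by norm_num) (by norm_num) henv₂.one henv₂.zero h10₂
      henv₂.len (by omega) (by omega)) (by omega) ?_
    rintro s₃ ⟨hF₃, h0₃, hm₃⟩
    have henv₃ := henv₂.frame hF₃ (by norm_num)
    have e : s₃.reg rZ + s₃.reg 0 = (X + 2 * B + j * N + 0 : ℕ) := by
      rw [henv₃.table, h0₃]; push_cast; ring
    refine Runs.seq_add ?_ (Runs.store (T := 0) (a := X + 2 * B + j * N + 0) ?_ ⟨?_, ?_⟩)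
    · rw [e, Nat.abs_cast]; exact_mod_cast (by omega)
    · simp only [State.reg_setReg, if_true]; rw [e]
    · exact ((hF₃.mono (by norm_num)).setReg (by norm_num)).setMem
    · have hone := henv₃.one
      simp only [State.mem_setMem, State.mem_setReg, State.reg_setReg]
      norm_num only [if_false]
      rw [hone, hm₃, hm₂, update_memOf_table henv.len_pos]
      congr 1
      funext w
      by_cases hw : w = j
      · rw [hw, Function.update_self]
        ext x
        simp only [Set.mem_insert_iff, Set.mem_ofPred_eq]
        omega
      · rw [Function.update_of_ne hw]
        ext x
        simp only [Set.mem_ofPred_eq]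
        omega
  · rintro s₂ ⟨hF₂, hm₂⟩
    refine ⟨hF₁.trans hF₂, ?_⟩
    rw [hm₂]
    simp

/-! ### The whole program -/

/-- The program that decides the problem. -/
def decisionProg (k : ℕ) : Prog :=
  .seq (setupProg k) (.seq parentProg (.seq sizeProg (.seq tableProg
    (.seq (mainProg k) (answerProg k)))))

theorem runs_decisionProg {k n W : ℕ} {d : ℤ} {G : Digraph (Fin n)}
    {arcs : List (Fin n × Fin n)} (harcs : IsArcList G arcs) (h : IsOutForest G) (hkW : k ≤ W)
    (hW : 3 + 2 * arcs.length + 4 * (n + 1) + 4 * ((n + 1) * (n + 1) ^ k) + d.natAbs ≤ W) :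
    Runs W (decisionProg k) (initialState arcs d)
      (k * (3 * (n + 1) + 6) + 15 + (arcs.length * 13 + 2 + (n * (n * 7 + 4) + 2 +
      ((n + 1) * (3 * (n + 1) + 7) + 2 +
      (n * (n * (processTime k (n + 1) ((n + 1) ^ k) + 10) + 5) + 2 +
      ((n + 1) ^ k * (k * (4 * (n + 1) ^ k + 11) + 11) + 4)))))) (fun s =>
        (MinMaxDissatisfaction k G d → s.reg 0 = 1) ∧
        (¬ MinMaxDissatisfaction k G d → s.reg 0 = 0)) := by
  have hpa := harcs.isParentMap
  unfold decisionProg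
  refine Runs.seq (runs_setupProg hkW hW) le_rfl ?_
  rintro s₁ ⟨henv₁, hM₁, hm₁⟩
  refine Runs.seq (runs_parentProg henv₁ hM₁ hm₁) le_rfl ?_
  rintro s₂ ⟨hF₂, hm₂⟩
  have henv₂ := henv₁.frame hF₂ (by norm_num)
  refine Runs.seq (runs_sizeProg h hpa henv₂ hm₂) le_rfl ?_
  rintro s₃ ⟨hF₃, hm₃⟩
  have henv₃ := henv₂.frame hF₃ (by norm_num)
  refine Runs.seq (runs_tableProg henv₃ hm₃) le_rfl ?_
  rintro s₄ ⟨hF₄, hm₄⟩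
  have henv₄ := henv₃.frame hF₄ (by norm_num)
  rw [← tables_empty (k := k) (G := G) (pa := parentOf arcs)] at hm₄
  refine Runs.seq (runs_mainProg henv₄ hkW h hpa (sizesFrom_zero G) hm₄) le_rfl ?_
  rintro s₅ ⟨hF₅, hm₅⟩
  have henv₅ := henv₄.frame hF₅ (by norm_num)
  refine Runs.mono (runs_answerProg henv₅ hkW (fun a ha => lt_of_mem_codes h ha.2) hm₅) le_rfl ?_
  rintro s₆ ⟨h1, h0⟩
  rw [minMaxDissatisfaction_iff_tables h hpa d]
  exact ⟨h1, h0⟩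

/-! ### Estimates of time and word size -/

theorem length_le_of_isArcList {n : ℕ} {G : Digraph (Fin n)} {arcs : List (Fin n × Fin n)}
    (h : IsArcList G arcs) : arcs.length ≤ n * n := by
  simpa using h.1.length_le_card

theorem decisionTime_le {k n m : ℕ} (hk : 1 ≤ k) (hm : m ≤ n * n) :
    k * (3 * (n + 1) + 6) + 15 + (m * 13 + 2 + (n * (n * 7 + 4) + 2 +
      ((n + 1) * (3 * (n + 1) + 7) + 2 +
      (n * (n * (processTime k (n + 1) ((n + 1) ^ k) + 10) + 5) + 2 +
      ((n + 1) ^ k * (k * (4 * (n + 1) ^ k + 11) + 11) + 4))))) ≤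
    (200 + 100 * k) * (n + 1) ^ (2 * k + 2) := by
  have hpow : (n + 1) ^ (2 * k + 2) = ((n + 1) ^ k) ^ 2 * (n + 1) ^ 2 := by
    rw [pow_add, pow_mul, pow_right_comm]
  -- This needs `1 ≤ k`; it lets `N ^ 2` absorb the terms with `B` in the cost of one item.
  have hBN : n + 1 ≤ (n + 1) ^ k := by
    simpa using Nat.pow_le_pow_right (n := n + 1) (by omega) hk
  rw [hpow]
  have hn : n ≤ n + 1 := by omega
  generalize (n + 1) ^ k = N at *
  generalize hB : n + 1 = B at *
  have hB1 : 1 ≤ B := by omega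
  have hN1 : 1 ≤ N := by omega
  set P := N ^ 2 * B ^ 2 with hP
  have hNN : N ^ 2 ≤ P := Nat.le_mul_of_pos_right _ (by positivity)
  have hBB : B ^ 2 ≤ P := Nat.le_mul_of_pos_left _ (by positivity)
  have hN2 : N ≤ N ^ 2 := by nlinarith
  have hB2 : B ≤ B ^ 2 := by nlinarith
  have hNB : B * N ≤ N ^ 2 := by nlinarith
  have hnn : n * n ≤ B ^ 2 := by nlinarith
  have hkB : k * B ≤ k * P := Nat.mul_le_mul_left k (by omega)
  have hkN : k * N ≤ k * N ^ 2 := Nat.mul_le_mul_left k hN2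
  have hkNB : k * (B * N) ≤ k * N ^ 2 := Nat.mul_le_mul_left k hNB
  have hkNN : k * N ^ 2 ≤ k * P := Nat.mul_le_mul_left k hNN
  have hkP : k ≤ k * P := Nat.le_mul_of_pos_right _ (by positivity)
  -- Here `23 = 4 + 3 + 16` collects the terms with factor `k`; `60` leaves slack for the others.
  have hPT : processTime k B N + 10 ≤ (60 + 23 * k) * N ^ 2 := by
    have e : processTime k B N = 6 * B + 13 + (4 * (k * N ^ 2) + 3 * (k * (B * N)) +
        16 * (k * N) + 9 * N) + (7 * N ^ 2 + 7 * N) := by unfold processTime; ring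
    rw [e, add_mul 60, mul_assoc 23]
    omega
  have hmain : n * n * (processTime k B N + 10) ≤ (60 + 23 * k) * P :=
    calc n * n * (processTime k B N + 10) ≤ B ^ 2 * ((60 + 23 * k) * N ^ 2) :=
          Nat.mul_le_mul hnn hPT
      _ = (60 + 23 * k) * P := by rw [hP]; ring
  have e1 : k * (3 * B + 6) = 3 * (k * B) + 6 * k := by ring
  have e2 : n * (n * 7 + 4) = 7 * (n * n) + 4 * n := by ring
  have e3 : B * (3 * B + 7) = 3 * B ^ 2 + 7 * B := by ring
  have e4 : n * (n * (processTime k B N + 10) + 5) =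
    n * n * (processTime k B N + 10) + 5 * n := by ring
  have e5 : N * (k * (4 * N + 11) + 11) = 4 * (k * N ^ 2) + 11 * (k * N) + 11 * N := by ring
  rw [e1, e2, e3, e4, e5, add_mul 200, mul_assoc 100]
  rw [add_mul 60, mul_assoc 23] at hmain
  omega

theorem word_bound {k n m D : ℕ} (hm : m ≤ n * n) :
    3 + 2 * m + 4 * (n + 1) + 4 * ((n + 1) * (n + 1) ^ k) + D ≤ (n + D + 2) ^ (200 + 100 * k) := by
  set q := n + D + 2 with hq
  have hq2 : 2 ≤ q := by omega
  have h1 : q ≤ q ^ (k + 2) := Nat.le_self_pow (by omega) q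
  have h2 : n * n ≤ q ^ (k + 2) := by
    calc n * n ≤ q * q := Nat.mul_le_mul (by omega) (by omega)
      _ = q ^ 2 := by ring
      _ ≤ q ^ (k + 2) := Nat.pow_le_pow_right (by omega) (by omega)
  have h3 : (n + 1) * (n + 1) ^ k ≤ q ^ (k + 2) := by
    calc (n + 1) * (n + 1) ^ k = (n + 1) ^ (k + 1) := by ring
      _ ≤ q ^ (k + 1) := Nat.pow_le_pow_left (by omega) _
      _ ≤ q ^ (k + 2) := Nat.pow_le_pow_right (by omega) (by omega)
  -- Since `2 ≤ q`, the constant factor becomes four more factors `q`. The exponent `k + 6` is then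
  -- raised to the constant used in the time bound, as one `C` serves both purposes.
  calc 3 + 2 * m + 4 * (n + 1) + 4 * ((n + 1) * (n + 1) ^ k) + D ≤ 2 ^ 4 * q ^ (k + 2) := by omega
    _ ≤ q ^ 4 * q ^ (k + 2) := Nat.mul_le_mul_right _ (Nat.pow_le_pow_left hq2 4)
    _ = q ^ (k + 6) := by ring
    _ ≤ q ^ (200 + 100 * k) := Nat.pow_le_pow_right (by omega) (by omega)

end CommonGraph

/-- For every number `k` of agents there are a program and a constant `C` such that the program
decides the problem on every out-forest, given by any list of its arcs, in at most
`C * (n + 1) ^ (2 * k + 2)` steps and with words of `O(log (n + |d| + 2))` bits; the answer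
(`1` for yes, `0` for no) is left in register `0`. -/
theorem mainTheorem5 (k : ℕ) :
    ∃ (p : CommonGraph.Prog) (C : ℕ),
      ∀ (n : ℕ) (G : Digraph (Fin n)) (arcs : List (Fin n × Fin n)) (d : ℤ),
        CommonGraph.IsArcList G arcs → CommonGraph.IsOutForest G →
        ∃ (t : ℕ) (s : CommonGraph.State),
          CommonGraph.Exec ((n + d.natAbs + 2) ^ C) p (CommonGraph.initialState arcs d) t s ∧
          t ≤ C * (n + 1) ^ (2 * k + 2) ∧
          (CommonGraph.MinMaxDissatisfaction k G d → s.reg 0 = 1) ∧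
          (¬ CommonGraph.MinMaxDissatisfaction k G d → s.reg 0 = 0) := by
  rcases Nat.eq_zero_or_pos k with rfl | hk
  -- Without agents the answer is always yes. The case is separate because the time estimate relies
  -- on `n + 1 ≤ (n + 1) ^ k`.
  · refine ⟨.const 0 1, 1, fun n G arcs d _ _ => ⟨1, _, .const _ 0 1 ?_, ?_, fun _ => ?_, fun h => ?_⟩⟩
    · rw [abs_one]; exact_mod_cast Nat.one_le_pow _ _ (by omega)
    · rw [one_mul]; exact Nat.one_le_pow _ _ (by omega)
    · simp [CommonGraph.State.reg_setReg]
    · exact absurd ⟨fun i => i.elim0, fun i => i.elim0, fun i => i.elim0⟩ h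
  · refine ⟨CommonGraph.decisionProg k, 200 + 100 * k, fun n G arcs d harcs hG => ?_⟩
    have hm := CommonGraph.length_le_of_isArcList harcs
    -- The number `k` occurs as a constant of the program and must itself be a word.
    have hkW : k ≤ (n + d.natAbs + 2) ^ (200 + 100 * k) := by
      calc k ≤ 200 + 100 * k := by omega
        _ ≤ (n + d.natAbs + 2) ^ (200 + 100 * k) := (Nat.lt_pow_self (by omega)).le
    obtain ⟨t, s, hexec, ht, hs⟩ :=
      CommonGraph.runs_decisionProg (d := d) harcs hG hkW (CommonGraph.word_bound hm)
    exact ⟨t, s, hexec, ht.trans (CommonGraph.decisionTime_le hk hm), hs⟩
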